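/- **Setting.** The statement is local, so Frobenius manifolds are written in flat coordinates. A (complex) Frobenius manifold $(M,\nabla^z,e,E,r,\eta)$ is given by an open set $M\subset\mathbb C^N$ with coordinates $u^a$ and $\nabla=d$; a holomorphic tensor $\mathcal A$, with $\mathcal A_a\,du^c=\mathcal A_{ab}^c\,du^b$, such that the connections $\nabla^z=\nabla+z\mathcal A$ on $T^*M$ are torsion-free and flat for all $z\in\mathbb C$; a flat vector field $e$ with $\mathcal A_e=1$; a vector field $E$ with $\nabla E$ flat and $[E,X\circ Y]=[E,X]\circ Y+X\circ[E,Y]+X\circ Y$, where $X\circ Y=(\mathcal A_X)^*Y$; a number $r\in\mathbb R$; and a non-degenerate symmetric form $\eta$ on $TM$ with $\nabla\eta=0$, $\eta(X\circ Y,Z)=\eta(X,Y\circ Z)$ and $\mathcal L_E\eta=(2-r)\eta$. Put $\mathcal U=\mathcal A_E$, $\mu=1-\frac r2+\nabla_E-\mathcal L_E$ on one-forms, and $\omega=\mathrm{Tr}(\mathcal A_a)\,du^a$. Let $M_0\subset M$ be the set of points at which $(T_uM,\circ)$ is a semisimple algebra; $M$ is semisimple if $M_0$ is dense in $M$. **Virasoro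 vector fields.** On the jet space, with coordinates $u^a_\ell$ ($\ell\ge0$, $u^a_0=u^a$), let $\partial=\sum_\ell u^a_{\ell+1}\,\partial/\partial u^a_\ell$, $\mathcal X=u_1^a\mathcal A_a$, $\delta_z=\partial_z+z^{-1}(\mu+\frac12)+\mathcal U$, and $\sigma(z)f=\sum_{\ell\ge0}\bigl((\partial+z\mathcal X)^\ell\mathcal X\bigr)\bigl(\tfrac{\partial f}{\partial u^a_\ell}du^a\bigr)$. Where $\mathcal X$ is invertible let $\mathbf s(z)=\sum_{k\ge1}z^{-k-1}\mathbf s_k$ with $\mathbf s_1=-(\mathcal X^*)^{-1}e$, $\mathbf s_{k+1}=(\mathcal X^*)^{-1}\partial\mathbf s_k$. For $k\ge-1$ put $\mathcal L_k=\mathrm{Res}_{z=0}\langle\mathbf s(z),z\,\delta_z^{k+1}\sigma(z)\rangle$. The genus-1 Virasoro equations for a function $\mathcal G$ of jets of finite order are $$\mathcal L_k\mathcal G=\sum_{\ell=0}^k\Bigl(\tfrac14\mathrm{Tr}\bigl(\mu\,\mathcal U^\ell\mu\,\mathcal U^{k-\ell}\bigr)+\tfrac1{24}\bigl\langle e,\mathcal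 U^\ell\mu\,\mathcal U^{k-\ell}\omega\bigr\rangle\Bigr),\qquad k\ge-1,\tag{V1}$$ at all jets at which $\mathcal X$ is invertible. **Canonical data.** Canonical coordinates on an open set $U\subset M_0$ are holomorphic functions $v^1,\dots,v^N$ on $U$ with a dual frame of vector fields $\pi_i=\partial/\partial v^i$ such that $\pi_i\circ\pi_j=\delta_{ij}\pi_i$ and $E=\sum_iv^i\pi_i$. Put $\eta_i=\eta(\pi_i,\pi_i)$, $\eta_{ij}=\pi_j(\eta_i)$ and $$\alpha=\tfrac18\sum_{i,j}(v^i-v^j)\frac{\eta_{ij}^2}{\eta_i\eta_j}\,dv^i .$$ The isomonodromic tau-function $\tau_I$ is defined by $d\log\tau_I=\alpha$. **Theorem.** Let $M$ be a semisimple Frobenius manifold. 1. Every point of $M_0$ has an open neighbourhood $U\subset M_0$ on which there are canonical coordinates, a function $\log\tau_I$ with $d\log\tau_I=\alpha$, and holomorphic branches of all $\log\eta_i$. 2. For every open $U\subset M_0$ and every choice of such data on $U$, the function $$\mathcal G=\log\tau_I-\tfrac1{48}\sum_i\log\eta_i$$ satisfies (V1) over $U$ for all $k\ge-1$. 3. In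 the situation of 2, this is the only solution up to a constant: if $n\ge0$, $W$ is a connected open set of $n$-jets with base points in $U$, and $f$ is a holomorphic function on $W$ that satisfies (V1) on $W$ for all $k\ge-1$, then $f-\mathcal G$ is constant on $W$. -/

import Mathlib

noncomputable section

/-- The partial derivative `∂_a g` of a function of the coordinates `u`. -/
def coordDeriv {N : ℕ} (a : Fin N) (g : (Fin N → ℂ) → ℂ) (u : Fin N → ℂ) : ℂ :=
  fderiv ℂ g u (Pi.single a 1)

/-- A connection on the cotangent bundle, written in coordinates as
`∇_a du^c = ∑_b (Γ_a)_b^c du^b` with `Γ u a b c = (Γ_a)_b^c`: its torsion. -/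
def connTorsion {N : ℕ} (Γ : (Fin N → ℂ) → Fin N → Matrix (Fin N) (Fin N) ℂ)
    (u : Fin N → ℂ) (a b c : Fin N) : ℂ :=
  Γ u a b c - Γ u b a c

/-- The curvature `R(∂_a, ∂_b) = ∂_a Γ_b - ∂_b Γ_a + [Γ_a, Γ_b]` of a connection on the cotangent
bundle, an endomorphism of the cotangent space. -/
def connCurvature {N : ℕ} (Γ : (Fin N → ℂ) → Fin N → Matrix (Fin N) (Fin N) ℂ)
    (u : Fin N → ℂ) (a b : Fin N) : Matrix (Fin N) (Fin N) ℂ :=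
  Matrix.of (fun c d => coordDeriv a (fun w => Γ w b c d) u - coordDeriv b (fun w => Γ w a c d) u)
    + (Γ u a * Γ u b - Γ u b * Γ u a)

/-- The endomorphism `A_X = ∑_a X^a A_a` of the cotangent space, for a tangent vector `X`. -/
def contractA {N : ℕ} (A : Fin N → Matrix (Fin N) (Fin N) ℂ) (X : Fin N → ℂ) :
    Matrix (Fin N) (Fin N) ℂ :=
  ∑ a, X a • A a

/-- The product `X ∘ Y = (A_X)^* Y` of tangent vectors. -/
def tangentMul {N : ℕ} (A : Fin N → Matrix (Fin N) (Fin N) ℂ) (X Y : Fin N → ℂ) : Fin N → ℂ :=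
  Matrix.vecMul Y (contractA A X)

/-- A (complex) Frobenius manifold of dimension `N`, in flat coordinates `u = (u^a)`: the
underlying manifold is an open subset `carrier` of `ℂ^N` and the flat torsion-free connection `∇`
is `d`. An endomorphism of the cotangent bundle is a matrix with entries `M b c = M_b^c`,
`M du^c = ∑_b M_b^c du^b`; tangent vectors and covectors are vectors of components. -/
structure FrobeniusManifold (N : ℕ) where
  carrier : Set (Fin N → ℂ)
  isOpen_carrier : IsOpen carrier
  /-- The tensor `A` of the pencil `∇^z = ∇ + z A`. -/
  A : (Fin N → ℂ) → Fin N → Matrix (Fin N) (Fin N) ℂ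
  differentiable_A : ∀ a b c, DifferentiableOn ℂ (fun u => A u a b c) carrier
  /-- Every connection of the pencil is torsion-free. -/
  torsion_eq_zero : ∀ u ∈ carrier, ∀ z : ℂ, ∀ a b c, connTorsion (fun w d => z • A w d) u a b c = 0
  /-- Every connection of the pencil is flat. -/
  curvature_eq_zero : ∀ u ∈ carrier, ∀ z : ℂ, ∀ a b, connCurvature (fun w d => z • A w d) u a b = 0
  /-- The identity vector field. -/
  e : (Fin N → ℂ) → Fin N → ℂ
  differentiable_e : DifferentiableOn ℂ e carrier
  flat_e : ∀ u ∈ carrier, ∀ a b, coordDeriv a (fun w => e w b) u = 0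
  contract_e : ∀ u ∈ carrier, contractA (A u) (e u) = 1
  /-- The Euler vector field. -/
  E : (Fin N → ℂ) → Fin N → ℂ
  differentiable_E : DifferentiableOn ℂ E carrier
  /-- `E` is a linear vector field: `∇E` is flat. -/
  linear_E : ∀ u ∈ carrier, ∀ a b c, coordDeriv a (coordDeriv b (fun w => E w c)) u = 0
  /-- `[E, X ∘ Y] = [E, X] ∘ Y + X ∘ [E, Y] + X ∘ Y`. -/
  euler : ∀ X Y : (Fin N → ℂ) → Fin N → ℂ, DifferentiableOn ℂ X carrier →
    DifferentiableOn ℂ Y carrier → ∀ u ∈ carrier,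
      VectorField.lieBracket ℂ E (fun w => tangentMul (A w) (X w) (Y w)) u =
        tangentMul (A u) (VectorField.lieBracket ℂ E X u) (Y u)
          + tangentMul (A u) (X u) (VectorField.lieBracket ℂ E Y u)
          + tangentMul (A u) (X u) (Y u)
  r : ℝ
  /-- The metric, `η u a b = η(∂_a, ∂_b)`. -/
  η : (Fin N → ℂ) → Matrix (Fin N) (Fin N) ℂ
  differentiable_η : ∀ a b, DifferentiableOn ℂ (fun u => η u a b) carrier
  symm_η : ∀ u ∈ carrier, (η u).IsSymm
  nondegenerate_η : ∀ u ∈ carrier, (η u).det ≠ 0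
  /-- `∇` (torsion-free) preserves `η`, so that it is the Levi-Civita connection of `η`. -/
  flat_η : ∀ u ∈ carrier, ∀ a b c, coordDeriv c (fun w => η w a b) u = 0
  /-- `η(X ∘ Y, Z) = η(X, Y ∘ Z)`. -/
  invariant_η : ∀ u ∈ carrier, ∀ X Y Z : Fin N → ℂ,
    tangentMul (A u) X Y ⬝ᵥ Matrix.mulVec (η u) Z = X ⬝ᵥ Matrix.mulVec (η u) (tangentMul (A u) Y Z)
  /-- `E η(X, Y) = η([E, X], Y) + η(X, [E, Y]) + (2 - r) η(X, Y)`. -/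
  conformal_η : ∀ X Y : (Fin N → ℂ) → Fin N → ℂ, DifferentiableOn ℂ X carrier →
    DifferentiableOn ℂ Y carrier → ∀ u ∈ carrier,
      fderiv ℂ (fun w => X w ⬝ᵥ Matrix.mulVec (η w) (Y w)) u (E u) =
        VectorField.lieBracket ℂ E X u ⬝ᵥ Matrix.mulVec (η u) (Y u)
          + X u ⬝ᵥ Matrix.mulVec (η u) (VectorField.lieBracket ℂ E Y u)
          + (2 - (r : ℂ)) * (X u ⬝ᵥ Matrix.mulVec (η u) (Y u))

namespace FrobeniusManifold

variable {N : ℕ} (F : FrobeniusManifold N)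

/-- The product of two tangent vectors at the point `u`. -/
def mul (u X Y : Fin N → ℂ) : Fin N → ℂ := tangentMul (F.A u) X Y

/-- `η(X, Y)` for tangent vectors `X`, `Y` at the point `u`. -/
def metric (u X Y : Fin N → ℂ) : ℂ := X ⬝ᵥ Matrix.mulVec (F.η u) Y

theorem mul_apply (u X Y : Fin N → ℂ) (c : Fin N) :
    F.mul u X Y c = ∑ b, ∑ a, Y b * (X a * F.A u a b c) := by
  simp [mul, tangentMul, contractA, Matrix.vecMul, dotProduct, Matrix.sum_apply, Finset.mul_sum]

theorem A_symm {u : Fin N → ℂ} (hu : u ∈ F.carrier) (a b c : Fin N) :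
    F.A u a b c = F.A u b a c := by
  have h := F.torsion_eq_zero u hu 1 a b c
  simpa [connTorsion, sub_eq_zero] using h

theorem A_comm {u : Fin N → ℂ} (hu : u ∈ F.carrier) (a b : Fin N) :
    F.A u a * F.A u b = F.A u b * F.A u a := by
  have h1 := F.curvature_eq_zero u hu 1 a b
  have h2 := F.curvature_eq_zero u hu (-1) a b
  have hneg : ∀ (x d : Fin N) (g : Fin N → (Fin N → ℂ) → ℂ),
      coordDeriv x (fun w => -(g d w)) u = -coordDeriv x (g d) u := by
    intro x d g
    simp [coordDeriv, fderiv_fun_neg]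
  ext c d
  have h1' := congrFun (congrFun h1 c) d
  have h2' := congrFun (congrFun h2 c) d
  have e1 := hneg a d (fun d w => F.A w b c d)
  have e2 := hneg b d (fun d w => F.A w a c d)
  simp only [connCurvature, one_smul, neg_smul, Matrix.add_apply, Matrix.of_apply,
    Matrix.sub_apply, Matrix.neg_apply, Matrix.zero_apply, neg_mul_neg] at h1' h2'
  rw [e1, e2] at h2'
  linear_combination (h1' + h2') / 2

theorem mul_comm_of_mem {u : Fin N → ℂ} (hu : u ∈ F.carrier) (X Y : Fin N → ℂ) :
    F.mul u X Y = F.mul u Y X := by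
  ext c
  rw [mul_apply, mul_apply, Finset.sum_comm]
  refine Finset.sum_congr rfl fun a _ => Finset.sum_congr rfl fun b _ => ?_
  rw [F.A_symm hu a b c]
  ring

theorem contractA_comm {u : Fin N → ℂ} (hu : u ∈ F.carrier) (X Y : Fin N → ℂ) :
    contractA (F.A u) X * contractA (F.A u) Y = contractA (F.A u) Y * contractA (F.A u) X := by
  simp only [contractA, Finset.sum_mul_sum, smul_mul_assoc, mul_smul_comm]
  rw [Finset.sum_comm]
  refine Finset.sum_congr rfl fun a _ => Finset.sum_congr rfl fun b _ => ?_
  rw [F.A_comm hu b a, smul_comm]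

theorem mul_assoc_of_mem {u : Fin N → ℂ} (hu : u ∈ F.carrier) (X Y Z : Fin N → ℂ) :
    F.mul u (F.mul u X Y) Z = F.mul u X (F.mul u Y Z) := by
  rw [F.mul_comm_of_mem hu (F.mul u X Y) Z, F.mul_comm_of_mem hu Y Z]
  simp only [mul, tangentMul, Matrix.vecMul_vecMul]
  rw [F.contractA_comm hu]

theorem e_mul_of_mem {u : Fin N → ℂ} (hu : u ∈ F.carrier) (X : Fin N → ℂ) :
    F.mul u (F.e u) X = X := by
  simp [mul, tangentMul, F.contract_e u hu]

theorem mul_add_vec (u X Y Z : Fin N → ℂ) :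
    F.mul u X (Y + Z) = F.mul u X Y + F.mul u X Z :=
  Matrix.add_vecMul _ Y Z

theorem mul_zero_vec (u X : Fin N → ℂ) : F.mul u X 0 = 0 := by
  simp [mul, tangentMul]

theorem add_mul_of_mem {u : Fin N → ℂ} (hu : u ∈ F.carrier) (X Y Z : Fin N → ℂ) :
    F.mul u (X + Y) Z = F.mul u X Z + F.mul u Y Z := by
  rw [F.mul_comm_of_mem hu (X + Y) Z, F.mul_comm_of_mem hu X Z, F.mul_comm_of_mem hu Y Z,
    F.mul_add_vec]

theorem zero_mul_of_mem {u : Fin N → ℂ} (hu : u ∈ F.carrier) (X : Fin N → ℂ) :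
    F.mul u 0 X = 0 := by
  rw [F.mul_comm_of_mem hu, F.mul_zero_vec]

/-- The tangent space at a point of the manifold, as a commutative ring under `∘`. -/
def TangentAlgebra (_u : F.carrier) : Type := Fin N → ℂ

instance (u : F.carrier) : AddCommGroup (F.TangentAlgebra u) :=
  inferInstanceAs (AddCommGroup (Fin N → ℂ))

instance (u : F.carrier) : CommRing (F.TangentAlgebra u) :=
  { (inferInstance : AddCommGroup (F.TangentAlgebra u)) with
    mul := fun X Y => F.mul u.1 X Y
    one := F.e u.1
    left_distrib := fun X Y Z => F.mul_add_vec u.1 X Y Z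
    right_distrib := fun X Y Z => F.add_mul_of_mem u.2 X Y Z
    zero_mul := fun X => F.zero_mul_of_mem u.2 X
    mul_zero := fun X => F.mul_zero_vec u.1 X
    mul_assoc := fun X Y Z => F.mul_assoc_of_mem u.2 X Y Z
    one_mul := fun X => F.e_mul_of_mem u.2 X
    mul_one := fun X => (F.mul_comm_of_mem u.2 X (F.e u.1)).trans (F.e_mul_of_mem u.2 X)
    mul_comm := fun X Y => F.mul_comm_of_mem u.2 X Y }

/-- The semisimple locus `M_0`. -/
def semisimpleLocus : Set (Fin N → ℂ) :=
  {u | ∃ hu : u ∈ F.carrier, IsSemisimpleRing (F.TangentAlgebra ⟨u, hu⟩)}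

/-- The Frobenius manifold is semisimple: the semisimple locus is dense. -/
def IsSemisimple : Prop := F.carrier ⊆ closure F.semisimpleLocus

/-- `μ = 1 - r/2 + ∇_E - L_E` on one-forms; `μ du^c = (1 - r/2) du^c - dE^c`. -/
def mu (u : Fin N → ℂ) : Matrix (Fin N) (Fin N) ℂ :=
  Matrix.of fun b c => (if b = c then 1 - (F.r : ℂ) / 2 else 0) - coordDeriv b (fun w => F.E w c) u

/-- `𝒰 = A_E`. -/
def calU (u : Fin N → ℂ) : Matrix (Fin N) (Fin N) ℂ := contractA (F.A u) (F.E u)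

/-- The socle one-form `ω = Tr(A_a) du^a`. -/
def socle (u : Fin N → ℂ) : Fin N → ℂ := fun a => (F.A u a).trace

end FrobeniusManifold

/-- Coordinates on the infinite jet space: `u ℓ a = u^a_ℓ`. -/
abbrev Jet (N : ℕ) := ℕ → Fin N → ℂ

/-- `∂_{ℓ,a} = ∂/∂u^a_ℓ`. -/
def jetPartial {N : ℕ} (ℓ : ℕ) (a : Fin N) (g : Jet N → ℂ) (u : Jet N) : ℂ :=
  lineDeriv ℂ g u (Pi.single ℓ (Pi.single a 1))

/-- `∂ = ∑_ℓ u^a_{ℓ+1} ∂_{ℓ,a}`, the derivative in the direction `(u_1, u_2, …)`. -/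
def totalDeriv {N : ℕ} (g : Jet N → ℂ) (u : Jet N) : ℂ :=
  lineDeriv ℂ g u (fun ℓ => u (ℓ + 1))

/-- The `n`-jet underlying an infinite jet. -/
def truncJet {N : ℕ} (n : ℕ) (u : Jet N) : Fin (n + 1) → Fin N → ℂ := fun ℓ => u ℓ

namespace FrobeniusManifold

variable {N : ℕ} (F : FrobeniusManifold N)

/-- `𝒳 = A_∂`, an endomorphism of the pull-back of the cotangent bundle to the jet space. -/
def calX (u : Jet N) : Matrix (Fin N) (Fin N) ℂ := contractA (F.A (u 0)) (u 1)

/-- `faaDiBruno n j` is the coefficient of `z^j` in `P_{n+1}(z) = (∂ + z 𝒳)^n 𝒳`. -/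
def faaDiBruno : ℕ → ℕ → Jet N → Matrix (Fin N) (Fin N) ℂ
  | 0, 0 => F.calX
  | 0, _ + 1 => fun _ => 0
  | n + 1, 0 => fun u => Matrix.of fun a b => totalDeriv (fun w => faaDiBruno n 0 w a b) u
  | n + 1, j + 1 => fun u =>
      Matrix.of (fun a b => totalDeriv (fun w => faaDiBruno n (j + 1) w a b) u)
        + F.calX u * faaDiBruno n j u

/-- The coefficients (indexed by powers of `z`) of the covector-valued series
`σ(z) f = ∑_ℓ P_{ℓ+1}(z) ∂_ℓ f`, where `∂_ℓ f = ∑_a (∂f/∂u^a_ℓ) du^a`. The sum over `ℓ` is finite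
for a function `f` of a jet of finite order. -/
def sigmaSeries (f : Jet N → ℂ) (u : Jet N) : ℤ → Fin N → ℂ
  | Int.ofNat k => ∑ᶠ ℓ : ℕ, Matrix.mulVec (F.faaDiBruno ℓ k u) (fun a => jetPartial ℓ a f u)
  | Int.negSucc _ => 0

/-- `δ_z = ∂_z + z⁻¹ (μ + 1/2) + 𝒰` acting on covector-valued Laurent series in `z`, given by their
coefficients. -/
def deltaZ (u : Fin N → ℂ) (θ : ℤ → Fin N → ℂ) : ℤ → Fin N → ℂ := fun j =>
  ((j : ℂ) + 1) • θ (j + 1)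
    + Matrix.mulVec (F.mu u + (1 / 2 : ℂ) • (1 : Matrix (Fin N) (Fin N) ℂ)) (θ (j + 1))
    + Matrix.mulVec (F.calU u) (θ j)

/-- `sVec j` is the vector field `s_{j+1}` along the jet space, in
`s(z) = ∑_{k ≥ 1} z^{-k-1} s_k`, where `s_1 = - (𝒳^*)⁻¹ e` and `s_{k+1} = (𝒳^*)⁻¹ ∂ s_k`. -/
def sVec : ℕ → Jet N → Fin N → ℂ
  | 0 => fun u => -Matrix.vecMul (F.e (u 0)) (F.calX u)⁻¹
  | j + 1 => fun u => Matrix.vecMul (fun a => totalDeriv (fun w => sVec j w a) u) (F.calX u)⁻¹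

/-- `virasoroField m` is the vector field `ℒ_{m-1} = Res_{z=0} ⟨s(z), z δ_z^m σ(z)⟩` on the part of
the jet space on which `𝒳` is invertible. -/
def virasoroField (m : ℕ) (f : Jet N → ℂ) (u : Jet N) : ℂ :=
  ∑ᶠ j : ℕ, F.sVec j u ⬝ᵥ ((F.deltaZ (u 0))^[m] (F.sigmaSeries f u)) (j : ℤ)

/-- The right-hand side of the genus one Virasoro equation for `k = m - 1`:
`∑_{ℓ=0}^k (1/4 Tr(μ 𝒰^ℓ μ 𝒰^{k-ℓ}) + 1/24 ⟨e, 𝒰^ℓ μ 𝒰^{k-ℓ} ω⟩)`. -/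
def genusOneRHS (m : ℕ) (u : Fin N → ℂ) : ℂ :=
  ∑ ℓ ∈ Finset.range m,
    ((1 / 4 : ℂ) * (F.mu u * F.calU u ^ ℓ * F.mu u * F.calU u ^ (m - 1 - ℓ)).trace
      + (1 / 24 : ℂ) * (F.e u ⬝ᵥ
          Matrix.mulVec (F.calU u ^ ℓ * F.mu u * F.calU u ^ (m - 1 - ℓ)) (F.socle u)))

/-- A function `f` of `n`-jets satisfies the genus one Virasoro equations
`ℒ_k f = ∑_{ℓ=0}^k (1/4 Tr(μ 𝒰^ℓ μ 𝒰^{k-ℓ}) + 1/24 ⟨e, 𝒰^ℓ μ 𝒰^{k-ℓ} ω⟩)` for all `k ≥ -1`, over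
the set `W` of `n`-jets (at the jets where `𝒳` is invertible). -/
def GenusOneVirasoro (n : ℕ) (W : Set (Fin (n + 1) → Fin N → ℂ))
    (f : (Fin (n + 1) → Fin N → ℂ) → ℂ) : Prop :=
  ∀ m : ℕ, ∀ u : Jet N, truncJet n u ∈ W → (F.calX u).det ≠ 0 →
    F.virasoroField m (fun w => f (truncJet n w)) u = F.genusOneRHS m (u 0)

/-- Canonical coordinates `v^i` on a set `U`: the vector fields `π_i = ∂/∂v^i` satisfy
`π_i ∘ π_j = δ_ij π_i`, and the additive constants in the `v^i` are such that `E = ∑ v^i π_i`. -/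
structure CanonicalCoordinates (U : Set (Fin N → ℂ)) where
  v : Fin N → (Fin N → ℂ) → ℂ
  π : Fin N → (Fin N → ℂ) → Fin N → ℂ
  differentiable_v : ∀ i, DifferentiableOn ℂ (v i) U
  dual : ∀ u ∈ U, ∀ i j, fderiv ℂ (v i) u (π j u) = if i = j then 1 else 0
  idempotent : ∀ u ∈ U, ∀ i j, F.mul u (π i u) (π j u) = if i = j then π i u else 0
  euler : ∀ u ∈ U, F.E u = ∑ i, v i u • π i u

namespace CanonicalCoordinates

variable {F} {U : Set (Fin N → ℂ)} (κ : F.CanonicalCoordinates U)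

/-- `η_i = η(π_i, π_i)`. -/
def etaI (i : Fin N) (u : Fin N → ℂ) : ℂ := F.metric u (κ.π i u) (κ.π i u)

/-- `η_ij = π_j(η_i)`. -/
def etaIJ (i j : Fin N) (u : Fin N → ℂ) : ℂ := fderiv ℂ (κ.etaI i) u (κ.π j u)

/-- The one-form `α = 1/8 ∑_{i,j} (v^i - v^j) η_ij² / (η_i η_j) dv^i`. -/
def alpha (u : Fin N → ℂ) : (Fin N → ℂ) →L[ℂ] ℂ :=
  ∑ i, ∑ j, ((1 / 8 : ℂ) * (κ.v i u - κ.v j u) * (κ.etaIJ i j u ^ 2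
    / (κ.etaI i u * κ.etaI j u))) • fderiv ℂ (κ.v i) u

/-- `T = log τ_I` on `U`, where `τ_I` is the isomonodromic tau-function: `d log τ_I = α`. -/
def IsLogTau (T : (Fin N → ℂ) → ℂ) : Prop := ∀ u ∈ U, HasFDerivAt T (κ.alpha u) u

/-- `L i` is a holomorphic branch of `log η_i` on `U`. -/
def IsLogEta (L : Fin N → (Fin N → ℂ) → ℂ) : Prop :=
  ∀ i, DifferentiableOn ℂ (L i) U ∧ ∀ u ∈ U, Complex.exp (L i u) = κ.etaI i u

end CanonicalCoordinates

end FrobeniusManifold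

/-- `G = log τ_I - 1/48 ∑_i log η_i`. -/
def genusOneG {N : ℕ} (T : (Fin N → ℂ) → ℂ) (L : Fin N → (Fin N → ℂ) → ℂ) (u : Fin N → ℂ) : ℂ :=
  T u - (1 / 48 : ℂ) * ∑ i, L i u

end

/-! At a semisimple point the idempotents `π_i` diagonalise all multiplications at once. In this
frame `𝒰` is `diag(v^i)`, and `μ` has zero diagonal and entries `(v^i - v^j) η_ij / (2 η_j)`
(`conj_mu`).

Existence of a solution: `G` depends on the base point only, so `σ(z) G = 𝒳 dG` has degree zero in
`z`. Since `δ_z` never raises degrees, `ℒ_k G = -⟨e, 𝒰^(k+1) dG⟩` (`virasoroField_base`), which in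
the frame is `-∑ (v^i)^(k+1) π_i(G)`. The right-hand side of (V1) is a double sum containing
geometric sums in `v^i, v^j`; the factors `v^i - v^j` of `μ` turn these into differences of powers.
With `η_ij = η_ji` and `∑_j η_ij = 0` both sides agree (`genusOneRHS_eq_fderiv_genusOneG`).

Existence of local data: idempotents extend holomorphically by the implicit function theorem,
because the linearised equation `2x - 1` is an involution (`isInvertible_fderiv_idemEq`). The dual
coframe `θ^i` is closed because the derivatives of `A` are symmetric, and `v^i = θ^i(E)`
(`exists_canonicalCoordinates`). Flatness gives the Darboux–Egoroff equations for `η_ik / (2 η_i)`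
(`fderiv_conn_π`); they make `α` closed (`fderiv_alphaCoeff_comm`), hence exact on a ball.

Uniqueness: suppose `𝒳` is invertible and the `v^i` are distinct. The `σ`-series of the difference
of two solutions is a polynomial in `z` killed by all functionals `θ ↦ Res ⟨s, z δ_z^m θ⟩`.
Polynomials of bounded degree with this property form a finite-dimensional space, stable under `δ_z`
modulo negative powers of `z`. An eigenvector would have its top coefficient in a single canonical
direction. In positive degree the next coefficient then yields a nonzero multiple of it that must
vanish, and in degree zero it pairs nontrivially with `s_1`; so the space is zero
(`eq_zero_of_forall_residue`). Triangularity of the `P_ℓ` turns this into equality of differentials.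
The remaining jets are reached by continuity along lines, and equal differentials on a connected set
leave only a constant. -/

noncomputable section

/-! ### Smoothness of holomorphic functions of several variables -/

open Metric in
/-- A complex differentiable function is locally Lipschitz. -/
theorem DifferentiableOn.exists_lipschitzOnWith_ball {E F : Type*} [NormedAddCommGroup E]
    [NormedSpace ℂ E] [NormedAddCommGroup F] [NormedSpace ℂ F] {f : E → F} {s : Set E}
    (hf : DifferentiableOn ℂ f s) (hs : IsOpen s) {p : E} (hp : p ∈ s) :
    ∃ K, ∃ R > 0, ball p R ⊆ s ∧ LipschitzOnWith K f (ball p R) := by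
  have hc : ContinuousAt f p := (hf.differentiableAt (hs.mem_nhds hp)).continuousAt
  have hev : ∀ᶠ x in nhds p, x ∈ s ∧ ‖f x‖ < ‖f p‖ + 1 :=
    (hs.eventually_mem hp).and (hc.norm.eventually_lt_const (by simp))
  obtain ⟨r, hr, hball⟩ := Metric.eventually_nhds_iff_ball.1 hev
  -- Cauchy's estimate on the complex line through `x` in direction `v`: the disc of radius `r / 4 /
  -- ‖v‖` moves `x` by at most `r / 4`, hence stays in the ball where `f` is bounded.
  have hbound : ∀ x ∈ ball p (r / 2), ‖fderiv ℂ f x‖ ≤ (‖f p‖ + 1) / (r / 4) := by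
    intro x hx
    refine ContinuousLinearMap.opNorm_le_bound _ (by positivity) fun v => ?_
    rcases eq_or_ne v 0 with rfl | hv
    · simp
    have hv' : 0 < ‖v‖ := norm_pos_iff.2 hv
    have hmem : ∀ t ∈ closedBall (0 : ℂ) (r / 4 / ‖v‖), x + t • v ∈ ball p r := by
      intro t ht
      rw [mem_closedBall_zero_iff, le_div_iff₀ hv'] at ht
      rw [mem_ball, dist_eq_norm] at hx ⊢
      calc ‖x + t • v - p‖ = ‖(x - p) + t • v‖ := by congr 1; abel
        _ ≤ ‖x - p‖ + ‖t • v‖ := norm_add_le _ _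
        _ < r := by rw [norm_smul]; linarith
    have hd : ∀ t ∈ closedBall (0 : ℂ) (r / 4 / ‖v‖),
        HasDerivAt (fun t : ℂ => f (x + t • v)) (fderiv ℂ f (x + t • v) v) t := by
      intro t ht
      have h1 := (hf.differentiableAt (hs.mem_nhds (hball _ (hmem t ht)).1)).hasFDerivAt
      have h2 : HasDerivAt (fun t : ℂ => x + t • v) v t := by
        simpa using ((hasDerivAt_id t).smul_const v).const_add x
      exact h1.comp_hasDerivAt t h2
    have h0 := (hd 0 (by simp; positivity)).deriv
    have hR : 0 < r / 4 / ‖v‖ := by positivity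
    have := Complex.norm_deriv_le_of_forall_mem_sphere_norm_le (f := fun t : ℂ => f (x + t • v))
      (c := 0) (C := ‖f p‖ + 1) hR
      (DifferentiableOn.diffContOnCl_ball (U := closedBall (0 : ℂ) (r / 4 / ‖v‖))
        (fun t ht => (hd t ht).differentiableAt.differentiableWithinAt) subset_rfl)
      (fun t ht => (hball _ (hmem t (sphere_subset_closedBall ht))).2.le)
    rw [h0] at this
    simp only [zero_smul, add_zero] at this
    calc _ ≤ _ := this
      _ = _ := by field_simp
  have hsub : ball p (r / 2) ⊆ ball p r := ball_subset_ball (by linarith)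
  refine ⟨⟨(‖f p‖ + 1) / (r / 4), by positivity⟩, r / 2, by positivity,
    fun x hx => (hball x (hsub hx)).1, ?_⟩
  exact (convex_ball p (r / 2)).lipschitzOnWith_of_nnnorm_fderiv_le
    (fun x hx => hf.differentiableAt (hs.mem_nhds (hball x (hsub hx)).1))
    (fun x hx => hbound x hx)

open Metric MeasureTheory in
/-- The directional derivatives of a complex differentiable function of several variables are
complex differentiable. -/
theorem DifferentiableOn.fderiv_apply_of_isOpen {E F : Type*} [NormedAddCommGroup E]
    [NormedSpace ℂ E] [FiniteDimensional ℂ E] [NormedAddCommGroup F] [NormedSpace ℂ F]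
    [FiniteDimensional ℂ F] {f : E → F} {s : Set E}
    (hf : DifferentiableOn ℂ f s) (hs : IsOpen s) (v : E) :
    DifferentiableOn ℂ (fun x => fderiv ℂ f x v) s := by
  intro p hp
  have : CompleteSpace F := FiniteDimensional.complete ℂ F
  obtain ⟨K, R, hR, hRs, hLip⟩ := hf.exists_lipschitzOnWith_ball hs hp
  obtain ⟨ρ, hρ, hρv⟩ : ∃ ρ > 0, ρ * ‖v‖ < R / 2 := by
    refine ⟨R / 4 / (‖v‖ + 1), by positivity, ?_⟩
    rw [div_mul_eq_mul_div, div_lt_iff₀ (by positivity)]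
    nlinarith [norm_nonneg v]
  have hmem : ∀ x ∈ ball p (R / 2), ∀ t ∈ closedBall (0 : ℂ) ρ, x + t • v ∈ ball p R := by
    intro x hx t ht
    rw [mem_closedBall_zero_iff] at ht
    rw [mem_ball, dist_eq_norm] at hx ⊢
    calc ‖x + t • v - p‖ = ‖(x - p) + t • v‖ := by congr 1; abel
      _ ≤ ‖x - p‖ + ‖t • v‖ := norm_add_le _ _
      _ < R := by
        rw [norm_smul]; nlinarith [mul_le_mul_of_nonneg_right ht (norm_nonneg v)]
  have hfd : ∀ y ∈ ball p R, HasFDerivAt f (fderiv ℂ f y) y := fun y hy =>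
    (hf.differentiableAt (hs.mem_nhds (hRs hy))).hasFDerivAt
  -- The integrand of Cauchy's formula for the derivative of `t ↦ f (x + t v)` at `0`. It involves
  -- `f` but not its derivative, so differentiating under the integral in `x` needs only that `f` is
  -- differentiable and locally Lipschitz.
  set G : E → ℝ → F := fun x θ =>
    _root_.deriv (circleMap 0 ρ) θ • ((circleMap 0 ρ θ - 0) ^ 2)⁻¹ • f (x + circleMap 0 ρ θ • v) with hG
  have hcm : ∀ θ, circleMap 0 ρ θ ∈ closedBall (0 : ℂ) ρ := fun θ =>
    circleMap_mem_closedBall 0 hρ.le θ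
  have hcne : ∀ θ, (circleMap 0 ρ θ - 0) ^ 2 ≠ 0 := fun θ => by
    simp [hρ.ne']
  have hcont : ∀ x ∈ ball p (R / 2), Continuous (G x) := by
    intro x hx
    have h1 : Continuous fun θ : ℝ => f (x + circleMap 0 ρ θ • v) := by
      refine continuous_iff_continuousAt.2 fun θ => ?_
      exact ContinuousAt.comp (f := fun θ : ℝ => x + circleMap 0 ρ θ • v) (g := f)
        (hfd _ (hmem x hx _ (hcm θ))).continuousAt
        (by fun_prop)
    have h2 : Continuous fun θ : ℝ => ((circleMap 0 ρ θ - 0) ^ 2)⁻¹ :=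
      Continuous.inv₀ (by fun_prop) hcne
    have h3 : Continuous fun θ : ℝ => _root_.deriv (circleMap 0 ρ) θ := by
      simp only [deriv_circleMap]; fun_prop
    exact h3.smul (h2.smul h1)
  have hform : ∀ x ∈ ball p (R / 2),
      fderiv ℂ f x v = (2 * Real.pi * Complex.I : ℂ)⁻¹ • ∫ θ in (0)..2 * Real.pi, G x θ := by
    intro x hx
    have hd : ∀ t : ℂ, x + t • v ∈ ball p R →
        HasDerivAt (fun t : ℂ => f (x + t • v)) (fderiv ℂ f (x + t • v) v) t := by
      intro t ht
      have h2 : HasDerivAt (fun t : ℂ => x + t • v) v t := by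
        simpa using ((hasDerivAt_id t).smul_const v).const_add x
      exact (hfd _ ht).comp_hasDerivAt t h2
    have hU : IsOpen ((fun t : ℂ => x + t • v) ⁻¹' ball p R) :=
      isOpen_ball.preimage (by fun_prop)
    have := Complex.two_pi_I_inv_smul_circleIntegral_sub_sq_inv_smul_of_differentiable hU
      (c := 0) (w₀ := 0) (R := ρ) (f := fun t : ℂ => f (x + t • v))
      (fun t ht => hmem x hx t ht)
      (fun t ht => (hd t ht).differentiableAt.differentiableWithinAt) (mem_ball_self hρ)
    rw [(hd 0 (hmem x hx 0 (by simp [hρ.le]))).deriv] at this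
    simp only [zero_smul, add_zero] at this
    rw [← this]
    rfl
  have hball : ball p (R / 2) ∈ nhds p := ball_mem_nhds p (by positivity)
  have hpm : p ∈ ball p (R / 2) := mem_ball_self (by positivity)
  borelize E
  have key := intervalIntegral.hasFDerivAt_integral_of_dominated_loc_of_lip (𝕜 := ℂ) (μ := volume)
    (a := 0) (b := 2 * Real.pi) (F := G) (x₀ := p) (s := ball p (R / 2))
    (F' := fun θ => _root_.deriv (circleMap 0 ρ) θ • ((circleMap 0 ρ θ - 0) ^ 2)⁻¹ •
      fderiv ℂ f (p + circleMap 0 ρ θ • v))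
    (bound := fun _ => ρ * (ρ ^ 2)⁻¹ * K) hball
    (Filter.eventually_of_mem hball fun x hx => (hcont x hx).aestronglyMeasurable)
    ((hcont p hpm).intervalIntegrable _ _)
    (by
      -- Continuity of the derivative is not yet known; measurability is enough here.
      have h1 : Measurable fun θ : ℝ => fderiv ℂ f (p + circleMap 0 ρ θ • v) :=
        (measurable_fderiv ℂ f).comp (by
          have : Continuous fun θ : ℝ => p + circleMap 0 ρ θ • v := by fun_prop
          exact this.measurable)
      have h3 : Continuous fun θ : ℝ => _root_.deriv (circleMap 0 ρ) θ := by
        simp only [deriv_circleMap]; fun_prop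
      have h2 : Continuous fun θ : ℝ => ((circleMap 0 ρ θ - 0) ^ 2)⁻¹ :=
        Continuous.inv₀ (by fun_prop) hcne
      have : ProperSpace E := FiniteDimensional.proper ℂ E
      have : FiniteDimensional ℂ (E →L[ℂ] F) := inferInstance
      have : ProperSpace (E →L[ℂ] F) := FiniteDimensional.proper ℂ _
      exact h3.aestronglyMeasurable.smul
        (h2.aestronglyMeasurable.smul h1.aestronglyMeasurable))
    (Filter.Eventually.of_forall fun θ _ => by
      refine LipschitzOnWith.of_dist_le_mul fun x hx y hy => ?_
      have := hLip.dist_le_mul _ (hmem x hx _ (hcm θ)) _ (hmem y hy _ (hcm θ))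
      rw [dist_add_right] at this
      simp only [hG, dist_eq_norm, ← smul_sub, norm_smul] at this ⊢
      have e1 : ‖_root_.deriv (circleMap 0 ρ) θ‖ = ρ := by simp [deriv_circleMap, abs_of_pos hρ]
      have e2 : ‖((circleMap 0 ρ θ - 0) ^ 2)⁻¹‖ = (ρ ^ 2)⁻¹ := by simp [abs_of_pos hρ]
      rw [e1, e2, Real.coe_nnabs, abs_of_nonneg (by positivity), mul_assoc, mul_assoc]
      gcongr)
    (by simp)
    (Filter.Eventually.of_forall fun θ _ => by
      have h1 := hfd _ (hmem p hpm _ (hcm θ))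
      have h2 : HasFDerivAt (fun x : E => x + circleMap 0 ρ θ • v)
          (ContinuousLinearMap.id ℂ E) p := (hasFDerivAt_id p).add_const _
      exact ((h1.comp p h2).const_smul _).const_smul _)
  refine DifferentiableAt.differentiableWithinAt ?_
  refine (key.2.differentiableAt.const_smul ((2 * Real.pi * Complex.I : ℂ)⁻¹)).congr_of_eventuallyEq
    (Filter.eventually_of_mem hball fun x hx => hform x hx)

/-- A complex differentiable function of several variables is smooth. -/
theorem DifferentiableOn.contDiffOn_nat_of_isOpen {E F : Type*} [NormedAddCommGroup E]
    [NormedSpace ℂ E] [FiniteDimensional ℂ E] [NormedAddCommGroup F] [NormedSpace ℂ F]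
    [FiniteDimensional ℂ F] {s : Set E} (hs : IsOpen s) (n : ℕ) :
    ∀ {f : E → F}, DifferentiableOn ℂ f s → ContDiffOn ℂ n f s := by
  induction n with
  | zero => exact fun hf => contDiffOn_zero.2 hf.continuousOn
  | succ n ih =>
    intro f hf
    -- In finite dimension it suffices that each directional derivative is `C^n`, and each is again
    -- holomorphic.
    have := contDiffOn_succ_of_fderiv_apply (n := n) hf (by simp) (fun y =>
      (ih (hf.fderiv_apply_of_isOpen hs y)).congr fun x hx => by
        rw [fderivWithin_of_isOpen hs hx])
    exact_mod_cast this

end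

/-! ### Frames of idempotents: multiplication, metric and `μ` -/

noncomputable section

open Matrix

/-- The entries of the inverse of a differentiable matrix-valued function are differentiable. -/
theorem DifferentiableAt.matrix_inv_apply {E : Type*} [NormedAddCommGroup E] [NormedSpace ℂ E]
    {n : ℕ} {M : E → Matrix (Fin n) (Fin n) ℂ} {x : E}
    (hM : ∀ i j, DifferentiableAt ℂ (fun y => M y i j) x) (hx : (M x).det ≠ 0) (i j : Fin n) :
    DifferentiableAt ℂ (fun y => (M y)⁻¹ i j) x := by
  have hdet : ∀ Q : E → Matrix (Fin n) (Fin n) ℂ,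
      (∀ i j, DifferentiableAt ℂ (fun y => Q y i j) x) →
        DifferentiableAt ℂ (fun y => (Q y).det) x := by
    intro Q hQ
    simp only [Matrix.det_apply]
    refine DifferentiableAt.fun_sum fun σ _ => DifferentiableAt.const_smul ?_ _
    exact (HasFDerivAt.finsetProd (u := Finset.univ) (g := fun k y => Q y (σ k) k)
      fun k _ => (hQ (σ k) k).hasFDerivAt).differentiableAt
  simp only [Matrix.inv_def, Ring.inverse_eq_inv', Matrix.smul_apply, smul_eq_mul,
    Matrix.adjugate_apply]
  refine DifferentiableAt.mul ((hdet M hM).inv hx) (hdet _ fun k l => ?_)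
  simp only [Matrix.updateRow_apply]
  split_ifs
  · exact differentiableAt_const _
  · exact hM k l

theorem fderiv_apply_eq_sum_coordDeriv {N : ℕ} (g : (Fin N → ℂ) → ℂ) (u x : Fin N → ℂ) :
    fderiv ℂ g u x = ∑ a, x a * coordDeriv a g u := by
  conv_lhs => rw [pi_eq_sum_univ' x]
  simp [coordDeriv, map_sum]

theorem fderiv_eq_zero_of_coordDeriv {N : ℕ} {g : (Fin N → ℂ) → ℂ} {u : Fin N → ℂ}
    (h : ∀ a, coordDeriv a g u = 0) : fderiv ℂ g u = 0 := by
  ext1 x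
  simp [fderiv_apply_eq_sum_coordDeriv, h]

theorem fderiv_apply_pi {N M : ℕ} {g : (Fin N → ℂ) → Fin M → ℂ} {u : Fin N → ℂ}
    (hg : DifferentiableAt ℂ g u) (x : Fin N → ℂ) (b : Fin M) :
    fderiv ℂ g u x b = fderiv ℂ (fun w => g w b) u x := by
  rw [fderiv_pi (fun b => differentiableAt_pi.1 hg b)]
  rfl

namespace FrobeniusManifold

variable {N : ℕ} (F : FrobeniusManifold N)

theorem mem_nhds_carrier {u : Fin N → ℂ} (hu : u ∈ F.carrier) : F.carrier ∈ nhds u :=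
  F.isOpen_carrier.mem_nhds hu

theorem differentiableAt_A {u : Fin N → ℂ} (hu : u ∈ F.carrier) (a b c : Fin N) :
    DifferentiableAt ℂ (fun w => F.A w a b c) u :=
  (F.differentiable_A a b c).differentiableAt (F.mem_nhds_carrier hu)

theorem differentiableAt_E {u : Fin N → ℂ} (hu : u ∈ F.carrier) : DifferentiableAt ℂ F.E u :=
  F.differentiable_E.differentiableAt (F.mem_nhds_carrier hu)

theorem hasFDerivAt_e {u : Fin N → ℂ} (hu : u ∈ F.carrier) :
    HasFDerivAt F.e (0 : (Fin N → ℂ) →L[ℂ] (Fin N → ℂ)) u := by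
  have hd := F.differentiable_e.differentiableAt (F.mem_nhds_carrier hu)
  have : fderiv ℂ F.e u = 0 := by
    ext x b
    rw [fderiv_apply_pi hd, fderiv_eq_zero_of_coordDeriv fun a => F.flat_e u hu a b]
    rfl
  exact this ▸ hd.hasFDerivAt

theorem hasFDerivAt_η {u : Fin N → ℂ} (hu : u ∈ F.carrier) (a b : Fin N) :
    HasFDerivAt (fun w => F.η w a b) (0 : (Fin N → ℂ) →L[ℂ] ℂ) u := by
  have hd := (F.differentiable_η a b).differentiableAt (F.mem_nhds_carrier hu)
  exact (fderiv_eq_zero_of_coordDeriv fun c => F.flat_η u hu a b c) ▸ hd.hasFDerivAt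

theorem metric_eq_toBilin' (u X Y : Fin N → ℂ) :
    F.metric u X Y = Matrix.toBilin' (F.η u) X Y :=
  (Matrix.toBilin'_apply' _ _ _).symm

theorem metric_eq_sum (u X Y : Fin N → ℂ) :
    F.metric u X Y = ∑ a, ∑ b, X a * (F.η u a b * Y b) := by
  simp [metric, dotProduct, mulVec, Finset.mul_sum]

theorem metric_comm {u : Fin N → ℂ} (hu : u ∈ F.carrier) (X Y : Fin N → ℂ) :
    F.metric u X Y = F.metric u Y X := by
  rw [metric_eq_sum, metric_eq_sum, Finset.sum_comm]
  refine Finset.sum_congr rfl fun a _ => Finset.sum_congr rfl fun b _ => ?_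
  rw [(F.symm_η u hu).apply]
  ring

theorem metric_mul {u : Fin N → ℂ} (hu : u ∈ F.carrier) (X Y Z : Fin N → ℂ) :
    F.metric u (F.mul u X Y) Z = F.metric u X (F.mul u Y Z) :=
  F.invariant_η u hu X Y Z

theorem eq_of_forall_metric {u : Fin N → ℂ} (hu : u ∈ F.carrier) {X Y : Fin N → ℂ}
    (h : ∀ Z, F.metric u X Z = F.metric u Y Z) : X = Y := by
  have hn : (F.η u).Nondegenerate := Matrix.nondegenerate_iff_det_ne_zero.2 (F.nondegenerate_η u hu)
  rw [← sub_eq_zero]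
  refine Matrix.Nondegenerate.eq_zero_of_ortho hn fun Z => ?_
  rw [sub_dotProduct, sub_eq_zero]
  exact h Z

/-- The Leibniz rule for the flat metric. -/
theorem hasFDerivAt_metric {u : Fin N → ℂ} (hu : u ∈ F.carrier) {X Y : (Fin N → ℂ) → Fin N → ℂ}
    (hX : DifferentiableAt ℂ X u) (hY : DifferentiableAt ℂ Y u) :
    DifferentiableAt ℂ (fun w => F.metric w (X w) (Y w)) u ∧
      ∀ x, fderiv ℂ (fun w => F.metric w (X w) (Y w)) u x =
        F.metric u (fderiv ℂ X u x) (Y u) + F.metric u (X u) (fderiv ℂ Y u x) := by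
  have hX' := fun a => (differentiableAt_pi.1 hX a).hasFDerivAt
  have hY' := fun a => (differentiableAt_pi.1 hY a).hasFDerivAt
  have key : HasFDerivAt (fun w => F.metric w (X w) (Y w))
      (∑ a, ∑ b, (X u a • (F.η u a b • fderiv ℂ (fun w => Y w b) u + Y u b • 0)
        + (F.η u a b * Y u b) • fderiv ℂ (fun w => X w a) u)) u := by
    simp only [metric_eq_sum]
    exact HasFDerivAt.fun_sum fun a _ => HasFDerivAt.fun_sum fun b _ =>
      HasFDerivAt.fun_mul (hX' a) (HasFDerivAt.fun_mul (F.hasFDerivAt_η hu a b) (hY' b))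
  refine ⟨key.differentiableAt, fun x => ?_⟩
  rw [key.fderiv]
  simp only [metric_eq_sum, fderiv_apply_pi hX, fderiv_apply_pi hY, ← Finset.sum_add_distrib]
  simp only [_root_.sum_apply]
  refine Finset.sum_congr rfl fun a _ => Finset.sum_congr rfl fun b _ => ?_
  simp
  ring

theorem vecMul_mu {u : Fin N → ℂ} (hu : u ∈ F.carrier) (X : Fin N → ℂ) :
    X ᵥ* F.mu u = (1 - (F.r : ℂ) / 2) • X - fderiv ℂ F.E u X := by
  ext c
  rw [Pi.sub_apply, fderiv_apply_pi (F.differentiableAt_E hu), fderiv_apply_eq_sum_coordDeriv]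
  simp [vecMul, dotProduct, mu, mul_sub, Finset.sum_sub_distrib, mul_comm]

/-- `μ` is antisymmetric with respect to the metric. -/
theorem metric_vecMul_mu {u : Fin N → ℂ} (hu : u ∈ F.carrier) (X Y : Fin N → ℂ) :
    F.metric u (X ᵥ* F.mu u) Y = -F.metric u X (Y ᵥ* F.mu u) := by
  -- On constant fields `η(X, Y)` is constant and `[E, X] = -dE(X)`, so conformality becomes a
  -- pointwise identity for `dE`. The shift `1 - r/2` in `μ` absorbs the factor `2 - r`.
  have h := F.conformal_η (fun _ => X) (fun _ => Y) (differentiableOn_const _)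
    (differentiableOn_const _) u hu
  have h0 := (F.hasFDerivAt_metric hu (differentiableAt_const X) (differentiableAt_const Y)).2
    (F.E u)
  simp only [metric] at h0
  rw [h0] at h
  simp only [VectorField.lieBracket_eq, fderiv_fun_const, Pi.zero_apply,
    _root_.zero_apply, zero_sub] at h
  rw [F.vecMul_mu hu, F.vecMul_mu hu]
  simp only [metric_eq_toBilin', ← Matrix.toBilin'_apply', map_neg, map_sub, map_smul,
    LinearMap.neg_apply, LinearMap.sub_apply, LinearMap.smul_apply, smul_eq_mul, map_zero,
    LinearMap.zero_apply] at h ⊢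
  linear_combination -h

/-- The compatibility of the Euler vector field with the product, for vector fields that are
defined near a point. -/
theorem lieBracket_E_mul {u : Fin N → ℂ} (hu : u ∈ F.carrier) {X Y : (Fin N → ℂ) → Fin N → ℂ}
    (hX : DifferentiableAt ℂ X u) (hY : DifferentiableAt ℂ Y u) :
    VectorField.lieBracket ℂ F.E (fun w => F.mul w (X w) (Y w)) u =
      F.mul u (VectorField.lieBracket ℂ F.E X u) (Y u)
        + F.mul u (X u) (VectorField.lieBracket ℂ F.E Y u) + F.mul u (X u) (Y u) := by
  -- The Euler axiom speaks of fields on all of `carrier`. Both sides depend only on first jets at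
  -- `u`, so a local field may be replaced by its first-order Taylor polynomial.
  have jet : ∀ {Z : (Fin N → ℂ) → Fin N → ℂ}, DifferentiableAt ℂ Z u →
      ∃ Z' : (Fin N → ℂ) → Fin N → ℂ, Differentiable ℂ Z' ∧ Z' u = Z u ∧
        HasFDerivAt Z' (fderiv ℂ Z u) u := by
    intro Z _
    have h : ∀ w, HasFDerivAt (fun w => Z u + fderiv ℂ Z u (w - u)) (fderiv ℂ Z u) w := fun w =>
      (((fderiv ℂ Z u).hasFDerivAt).comp w ((hasFDerivAt_id w).sub_const u)).const_add (Z u)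
    exact ⟨_, fun w => (h w).differentiableAt, by simp, h u⟩
  obtain ⟨X', hX'd, hX'u, hX'⟩ := jet hX
  obtain ⟨Y', hY'd, hY'u, hY'⟩ := jet hY
  have hd : ∀ {P Q : (Fin N → ℂ) → Fin N → ℂ}, DifferentiableAt ℂ P u → DifferentiableAt ℂ Q u →
      ∀ c, HasFDerivAt (fun w => F.mul w (P w) (Q w) c)
        (∑ b, ∑ a, (Q u b • (P u a • fderiv ℂ (fun w => F.A w a b c) u
          + F.A u a b c • fderiv ℂ (fun w => P w a) u)
          + (P u a * F.A u a b c) • fderiv ℂ (fun w => Q w b) u)) u := by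
    intro P Q hP hQ c
    simp only [mul_apply]
    exact HasFDerivAt.fun_sum fun b _ => HasFDerivAt.fun_sum fun a _ =>
      HasFDerivAt.fun_mul (differentiableAt_pi.1 hQ b).hasFDerivAt
        (HasFDerivAt.fun_mul (differentiableAt_pi.1 hP a).hasFDerivAt
          (F.differentiableAt_A hu a b c).hasFDerivAt)
  have hcomp : ∀ {Z Z' : (Fin N → ℂ) → Fin N → ℂ}, DifferentiableAt ℂ Z u →
      HasFDerivAt Z' (fderiv ℂ Z u) u → ∀ a,
        fderiv ℂ (fun w => Z' w a) u = fderiv ℂ (fun w => Z w a) u := by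
    intro Z Z' hZ hZ' a
    ext1 x
    rw [← fderiv_apply_pi hZ, ← fderiv_apply_pi hZ'.differentiableAt, hZ'.fderiv]
  have hmul : fderiv ℂ (fun w => F.mul w (X' w) (Y' w)) u =
      fderiv ℂ (fun w => F.mul w (X w) (Y w)) u := by
    have h1 := hd hX'.differentiableAt hY'.differentiableAt
    have h2 := hd hX hY
    rw [fderiv_pi fun c => (h1 c).differentiableAt, fderiv_pi fun c => (h2 c).differentiableAt]
    congr 1
    ext1 c
    rw [(h1 c).fderiv, (h2 c).fderiv]
    simp only [hX'u, hY'u, hcomp hX hX', hcomp hY hY']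
  have h := F.euler X' Y' hX'd.differentiableOn hY'd.differentiableOn u hu
  change VectorField.lieBracket ℂ F.E (fun w => F.mul w (X' w) (Y' w)) u = _ at h
  simp only [VectorField.lieBracket_eq, hmul, hX'.fderiv, hY'.fderiv, hX'u, hY'u] at h ⊢
  exact h

/-- The commutator part of the curvature vanishes by `A_comm`, leaving the part linear in `z`. This
symmetry is what makes the dual coframe closed. -/
theorem coordDeriv_A_comm {u : Fin N → ℂ} (hu : u ∈ F.carrier) (a b c d : Fin N) :
    coordDeriv a (fun w => F.A w b c d) u = coordDeriv b (fun w => F.A w a c d) u := by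
  have h := congrFun (congrFun (F.curvature_eq_zero u hu 1 a b) c) d
  simp only [connCurvature, one_smul, F.A_comm hu b a, sub_self, add_zero, of_apply,
    Matrix.zero_apply] at h
  exact sub_eq_zero.1 h

/-- The rows of `P` are a frame of orthogonal idempotents of the tangent space at `u`, and the
columns of `Θ` are the dual frame. -/
structure IsFrame (u : Fin N → ℂ) (P Θ : Matrix (Fin N) (Fin N) ℂ) : Prop where
  mem : u ∈ F.carrier
  mul_eq_one : P * Θ = 1
  idem : ∀ i j, F.mul u (P i) (P j) = if i = j then P i else 0

namespace IsFrame

variable {F} {u : Fin N → ℂ} {P Θ : Matrix (Fin N) (Fin N) ℂ} (h : F.IsFrame u P Θ)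
include h

theorem mul_eq_one' : Θ * P = 1 := mul_eq_one_comm.1 h.mul_eq_one

/-- Multiplication by `X` scales `π_i` by the `i`-th frame component of `X`: the simultaneous
diagonalisation on which all later matrix computations rest. -/
theorem contractA_eq (X : Fin N → ℂ) :
    contractA (F.A u) X = Θ * diagonal (X ᵥ* Θ) * P := by
  have hrow : P * contractA (F.A u) X = diagonal (X ᵥ* Θ) * P := by
    refine funext fun i => ?_
    have hX : X = ∑ k, (X ᵥ* Θ) k • P k := by
      rw [← vecMul_eq_sum, vecMul_vecMul, h.mul_eq_one', vecMul_one]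
    rw [mul_apply_eq_vecMul]
    refine Eq.trans (b := F.mul u X (P i)) rfl ?_
    rw [F.mul_comm_of_mem h.mem]
    have hk : ∀ k, P k ᵥ* contractA (F.A u) (P i) = if k = i then P k else 0 := fun k =>
      (F.mul_comm_of_mem h.mem (P i) (P k)).trans (h.idem k i)
    conv_lhs => rw [hX]
    simp only [mul, tangentMul, sum_vecMul, smul_vecMul, hk]
    ext c
    simp [diagonal_mul, ite_apply]
  rw [mul_assoc, ← hrow, ← mul_assoc, h.mul_eq_one', one_mul]

theorem conj_contractA (X : Fin N → ℂ) :
    P * contractA (F.A u) X * Θ = diagonal (X ᵥ* Θ) := by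
  rw [h.contractA_eq, mul_assoc, mul_assoc, mul_assoc, h.mul_eq_one, mul_one, ← mul_assoc,
    h.mul_eq_one, one_mul]

theorem conj_mul (M M' : Matrix (Fin N) (Fin N) ℂ) :
    P * (M * M') * Θ = (P * M * Θ) * (P * M' * Θ) := by
  simp only [mul_assoc]
  rw [← mul_assoc Θ P, h.mul_eq_one', one_mul]

theorem conj_pow (M : Matrix (Fin N) (Fin N) ℂ) (k : ℕ) :
    P * M ^ k * Θ = (P * M * Θ) ^ k := by
  induction k with
  | zero => simp [h.mul_eq_one]
  | succ k ih => rw [pow_succ, h.conj_mul, ih, pow_succ]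

theorem trace_conj (M : Matrix (Fin N) (Fin N) ℂ) : (P * M * Θ).trace = M.trace := by
  rw [trace_mul_comm, ← mul_assoc, h.mul_eq_one', one_mul]

theorem eq_sum (X : Fin N → ℂ) : X = ∑ k, (X ᵥ* Θ) k • P k := by
  rw [← vecMul_eq_sum, vecMul_vecMul, h.mul_eq_one', vecMul_one]

theorem e_vecMul : F.e u ᵥ* Θ = 1 := by
  have := h.conj_contractA (F.e u)
  rw [F.contract_e u h.mem, mul_one, h.mul_eq_one] at this
  exact (diagonal_injective (this.symm.trans diagonal_one.symm))

theorem row_vecMul (i : Fin N) : P i ᵥ* Θ = Pi.single i 1 := by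
  have := congrFun h.mul_eq_one i
  rw [mul_apply_eq_vecMul] at this
  refine this.trans (funext fun j => ?_)
  simp [one_apply, Pi.single_apply, eq_comm]

theorem e_eq_sum : F.e u = ∑ k, P k := by
  refine (h.eq_sum (F.e u)).trans (Finset.sum_congr rfl fun k _ => ?_)
  rw [h.e_vecMul]
  exact one_smul ℂ (P k)

/-- Invariance: `η(π_i ∘ π_i, π_j) = η(π_i, π_i ∘ π_j)`, and the last product is zero. -/
theorem metric_row_of_ne {i j : Fin N} (hij : i ≠ j) : F.metric u (P i) (P j) = 0 := by
  have h1 := F.metric_mul h.mem (P i) (P i) (P j)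
  rw [h.idem, h.idem, if_pos rfl, if_neg hij] at h1
  rw [h1]
  simp [metric]

theorem metric_row_right (X : Fin N → ℂ) (j : Fin N) :
    F.metric u X (P j) = (X ᵥ* Θ) j * F.metric u (P j) (P j) := by
  conv_lhs => rw [h.eq_sum X]
  rw [metric_eq_toBilin', map_sum, LinearMap.sum_apply, Finset.sum_eq_single j]
  · simp [metric_eq_toBilin']
  · intro b _ hb
    rw [map_smul, LinearMap.smul_apply, ← metric_eq_toBilin', h.metric_row_of_ne hb, smul_zero]
  · simp

theorem metric_row_ne_zero (i : Fin N) : F.metric u (P i) (P i) ≠ 0 := by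
  intro h0
  have : P i = 0 := by
    refine F.eq_of_forall_metric h.mem fun Z => ?_
    rw [F.metric_comm h.mem, h.metric_row_right, h0, mul_zero]
    simp [metric]
  have h1 := h.row_vecMul i
  rw [this] at h1
  simpa using congrFun h1 i

theorem metric_e (i : Fin N) : F.metric u (P i) (F.e u) = F.metric u (P i) (P i) := by
  rw [F.metric_comm h.mem, h.metric_row_right, h.e_vecMul, Pi.one_apply, one_mul]

theorem conj_mu_apply (i j : Fin N) :
    (P * F.mu u * Θ) i j * F.metric u (P j) (P j) = F.metric u (P i ᵥ* F.mu u) (P j) := by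
  rw [h.metric_row_right (P i ᵥ* F.mu u), mul_apply_eq_vecMul, mul_apply_eq_vecMul]

/-- Antisymmetry of `μ` together with orthogonality and `η_i ≠ 0`. In the uniqueness proof this
keeps `μ` from cancelling the shift `k + 3/2`. -/
theorem conj_mu_diag (i : Fin N) : (P * F.mu u * Θ) i i = 0 := by
  have h1 := F.metric_vecMul_mu h.mem (P i) (P i)
  rw [F.metric_comm h.mem (P i), ← h.conj_mu_apply] at h1
  have := h.metric_row_ne_zero i
  have h2 : (P * F.mu u * Θ) i i * F.metric u (P i) (P i) = 0 := by linear_combination h1 / 2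
  exact (mul_eq_zero.1 h2).resolve_right this

end IsFrame

end FrobeniusManifold

end

/-! ### Canonical coordinates and the flat connection -/

noncomputable section

open Matrix

theorem DifferentiableOn.fderiv_of_isOpen {E F : Type*} [NormedAddCommGroup E]
    [NormedSpace ℂ E] [FiniteDimensional ℂ E] [NormedAddCommGroup F] [NormedSpace ℂ F]
    [FiniteDimensional ℂ F] {f : E → F} {s : Set E} (hf : DifferentiableOn ℂ f s)
    (hs : IsOpen s) : DifferentiableOn ℂ (fderiv ℂ f) s := by
  have h := (contDiffOn_succ_iff_fderiv_of_isOpen (n := 1) hs).1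
    (by exact_mod_cast hf.contDiffOn_nat_of_isOpen hs 2)
  exact h.2.2.differentiableOn (by simp)

theorem DifferentiableOn.fderiv_fderiv_comm {E F : Type*} [NormedAddCommGroup E]
    [NormedSpace ℂ E] [FiniteDimensional ℂ E] [NormedAddCommGroup F] [NormedSpace ℂ F]
    [FiniteDimensional ℂ F] {f : E → F} {s : Set E} (hf : DifferentiableOn ℂ f s)
    (hs : IsOpen s) {p : E} (hp : p ∈ s) (x y : E) :
    fderiv ℂ (fderiv ℂ f) p x y = fderiv ℂ (fderiv ℂ f) p y x :=
  ((hf.contDiffOn_nat_of_isOpen hs 2).contDiffAt (hs.mem_nhds hp)).isSymmSndFDerivAt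
    (by simp) x y

/-- The derivative of `w ↦ Df(w) (X w)`. -/
theorem DifferentiableOn.hasFDerivAt_fderiv_apply {E F : Type*} [NormedAddCommGroup E]
    [NormedSpace ℂ E] [FiniteDimensional ℂ E] [NormedAddCommGroup F] [NormedSpace ℂ F]
    [FiniteDimensional ℂ F] {f : E → F} {s : Set E} (hf : DifferentiableOn ℂ f s)
    (hs : IsOpen s) {p : E} (hp : p ∈ s) {X : E → E} (hX : DifferentiableAt ℂ X p) :
    DifferentiableAt ℂ (fun w => fderiv ℂ f w (X w)) p ∧
      ∀ x, fderiv ℂ (fun w => fderiv ℂ f w (X w)) p x =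
        fderiv ℂ (fderiv ℂ f) p x (X p) + fderiv ℂ f p (fderiv ℂ X p x) := by
  have h := ((hf.fderiv_of_isOpen hs).differentiableAt (hs.mem_nhds hp)).hasFDerivAt.clm_apply
    hX.hasFDerivAt
  refine ⟨h.differentiableAt, fun x => ?_⟩
  rw [h.fderiv]
  simp [add_comm]

theorem IsOpen.fderiv_congr {E F : Type*} [NormedAddCommGroup E] [NormedSpace ℂ E]
    [NormedAddCommGroup F] [NormedSpace ℂ F] {f g : E → F} {s : Set E} (hs : IsOpen s) {p : E}
    (hp : p ∈ s) (h : ∀ w ∈ s, f w = g w) : fderiv ℂ f p = fderiv ℂ g p :=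
  Filter.EventuallyEq.fderiv_eq (Filter.eventually_of_mem (hs.mem_nhds hp) h)

namespace FrobeniusManifold.CanonicalCoordinates

variable {N : ℕ} {F : FrobeniusManifold N} {U : Set (Fin N → ℂ)} (κ : F.CanonicalCoordinates U)

/-- The matrix whose rows are the vectors `π_i`. -/
def frame (u : Fin N → ℂ) : Matrix (Fin N) (Fin N) ℂ := of fun i b => κ.π i u b

/-- The matrix whose columns are the one-forms `dv^j`. -/
def coframe (u : Fin N → ℂ) : Matrix (Fin N) (Fin N) ℂ := of fun b j => coordDeriv b (κ.v j) u

theorem vecMul_coframe (u X : Fin N → ℂ) (j : Fin N) :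
    (X ᵥ* κ.coframe u) j = fderiv ℂ (κ.v j) u X := by
  simp [vecMul, dotProduct, coframe, fderiv_apply_eq_sum_coordDeriv]

theorem isFrame (hUF : U ⊆ F.carrier) {u : Fin N → ℂ} (hu : u ∈ U) :
    F.IsFrame u (κ.frame u) (κ.coframe u) where
  mem := hUF hu
  mul_eq_one := by
    ext i j
    rw [mul_apply_eq_vecMul]
    refine (κ.vecMul_coframe u (κ.π i u) j).trans ((κ.dual u hu j i).trans ?_)
    simp [one_apply, eq_comm]
  idem := κ.idempotent u hu

variable (hU : IsOpen U) (hUF : U ⊆ F.carrier) {u : Fin N → ℂ} (hu : u ∈ U)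

section

include hUF hu

theorem ext_fderiv_v {X Y : Fin N → ℂ}
    (h : ∀ l, fderiv ℂ (κ.v l) u X = fderiv ℂ (κ.v l) u Y) : X = Y := by
  have hf := κ.isFrame hUF hu
  rw [hf.eq_sum X, hf.eq_sum Y]
  simp only [vecMul_coframe, h]

theorem etaI_ne_zero (i : Fin N) : κ.etaI i u ≠ 0 := (κ.isFrame hUF hu).metric_row_ne_zero i

theorem e_eq_sum_π : F.e u = ∑ i, κ.π i u := (κ.isFrame hUF hu).e_eq_sum

end

include hU hUF

/-- The structure only asks for holomorphic `v^i`. The frame is the inverse of the matrix of the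
`dv^j`, whose entries are derivatives of holomorphic functions. -/
theorem differentiableOn_π (i : Fin N) : DifferentiableOn ℂ (κ.π i) U := by
  intro u hu
  refine DifferentiableAt.differentiableWithinAt (differentiableAt_pi.2 fun b => ?_)
  have h := DifferentiableAt.matrix_inv_apply (M := κ.coframe) (x := u)
    (fun b j => ((κ.differentiable_v j).fderiv_apply_of_isOpen hU (Pi.single b 1)).differentiableAt
      (hU.mem_nhds hu))
    (by
      intro h0
      have := congrArg Matrix.det (κ.isFrame hUF hu).mul_eq_one
      rw [det_mul, h0] at this
      simp at this) i b
  refine h.congr_of_eventuallyEq (Filter.eventually_of_mem (hU.mem_nhds hu) fun w hw => ?_)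
  change κ.frame w i b = (κ.coframe w)⁻¹ i b
  rw [inv_eq_left_inv (κ.isFrame hUF hw).mul_eq_one]

include hu

theorem differentiableAt_π (i : Fin N) : DifferentiableAt ℂ (κ.π i) u :=
  (κ.differentiableOn_π hU hUF i).differentiableAt (hU.mem_nhds hu)

theorem fderiv_v_fderiv_π (l k : Fin N) (x : Fin N → ℂ) :
    fderiv ℂ (κ.v l) u (fderiv ℂ (κ.π k) u x) =
      -fderiv ℂ (fderiv ℂ (κ.v l)) u x (κ.π k u) := by
  have h := ((κ.differentiable_v l).hasFDerivAt_fderiv_apply hU hu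
    (κ.differentiableAt_π hU hUF hu k)).2 x
  have h0 : fderiv ℂ (fun w => fderiv ℂ (κ.v l) w (κ.π k w)) u = 0 := by
    rw [hU.fderiv_congr hu fun w hw => κ.dual w hw l k]
    simp
  rw [h0, _root_.zero_apply] at h
  linear_combination -h

/-- The vector fields `π_i` commute. -/
theorem fderiv_π_comm (i k : Fin N) :
    fderiv ℂ (κ.π k) u (κ.π i u) = fderiv ℂ (κ.π i) u (κ.π k u) := by
  refine κ.ext_fderiv_v hUF hu fun l => ?_
  rw [κ.fderiv_v_fderiv_π hU hUF hu, κ.fderiv_v_fderiv_π hU hUF hu,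
    (κ.differentiable_v l).fderiv_fderiv_comm hU hu]

theorem differentiableAt_etaI (i : Fin N) : DifferentiableAt ℂ (κ.etaI i) u :=
  (F.hasFDerivAt_metric (hUF hu) (κ.differentiableAt_π hU hUF hu i)
    (κ.differentiableAt_π hU hUF hu i)).1

theorem fderiv_metric_π (i j k : Fin N) :
    F.metric u (fderiv ℂ (κ.π k) u (κ.π i u)) (κ.π j u)
      + F.metric u (κ.π k u) (fderiv ℂ (κ.π j) u (κ.π i u)) =
        if k = j then κ.etaIJ k i u else 0 := by
  rw [← (F.hasFDerivAt_metric (hUF hu) (κ.differentiableAt_π hU hUF hu k)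
    (κ.differentiableAt_π hU hUF hu j)).2]
  split_ifs with h
  · subst h
    rfl
  · rw [hU.fderiv_congr (f := fun w => F.metric w (κ.π k w) (κ.π j w)) (g := fun _ => 0) hu fun w hw =>
      (κ.isFrame hUF hw).metric_row_of_ne h]
    simp

/-- The Koszul formula for the flat connection in the frame `π`. -/
theorem metric_fderiv_π (i k j : Fin N) :
    2 * F.metric u (fderiv ℂ (κ.π k) u (κ.π i u)) (κ.π j u) =
      (if k = j then κ.etaIJ k i u else 0) + (if i = j then κ.etaIJ i k u else 0)
        - (if i = k then κ.etaIJ i j u else 0) := by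
  have h1 := κ.fderiv_metric_π hU hUF hu i j k
  have h2 := κ.fderiv_metric_π hU hUF hu k j i
  have h3 := κ.fderiv_metric_π hU hUF hu j k i
  rw [← h1, ← h2, ← h3, κ.fderiv_π_comm hU hUF hu k i, κ.fderiv_π_comm hU hUF hu j i,
    κ.fderiv_π_comm hU hUF hu j k, F.metric_comm (hUF hu) (κ.π k u),
    F.metric_comm (hUF hu) (κ.π i u) (fderiv ℂ (κ.π j) u (κ.π k u))]
  ring

/-- Differentiate `η_i = η(π_i, e)`, in which both `η` and `e` are flat. -/
theorem etaIJ_eq (i j : Fin N) :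
    κ.etaIJ i j u = F.metric u (fderiv ℂ (κ.π i) u (κ.π j u)) (F.e u) := by
  have h1 := (F.hasFDerivAt_metric (hUF hu) (κ.differentiableAt_π hU hUF hu i)
    (F.hasFDerivAt_e (hUF hu)).differentiableAt).2 (κ.π j u)
  rw [(F.hasFDerivAt_e (hUF hu)).fderiv, hU.fderiv_congr (f := fun w => F.metric w (κ.π i w) (F.e w)) (g := κ.etaI i) hu
    fun w hw => (κ.isFrame hUF hw).metric_e i] at h1
  rw [etaIJ, h1]
  simp [metric]

/-- The Egoroff property: it reduces to the commutation of the `π_i`. -/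
theorem etaIJ_symm (i j : Fin N) : κ.etaIJ i j u = κ.etaIJ j i u := by
  rw [κ.etaIJ_eq hU hUF hu, κ.etaIJ_eq hU hUF hu, κ.fderiv_π_comm hU hUF hu]

/-- The unit vector field commutes with the `π_i`. -/
theorem fderiv_π_e (i : Fin N) : fderiv ℂ (κ.π i) u (F.e u) = 0 := by
  have h := hU.fderiv_congr hu fun w hw => κ.e_eq_sum_π hUF hw
  rw [(F.hasFDerivAt_e (hUF hu)).fderiv,
    fderiv_fun_sum fun i _ => κ.differentiableAt_π hU hUF hu i] at h
  have h' := congrArg (fun L : (Fin N → ℂ) →L[ℂ] (Fin N → ℂ) => L (κ.π i u)) h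
  simp only [_root_.sum_apply, _root_.zero_apply] at h'
  rw [κ.e_eq_sum_π hUF hu, map_sum, h']
  exact Finset.sum_congr rfl fun k _ => κ.fderiv_π_comm hU hUF hu k i

theorem fderiv_etaI_e (i : Fin N) : fderiv ℂ (κ.etaI i) u (F.e u) = 0 := by
  refine ((F.hasFDerivAt_metric (hUF hu) (κ.differentiableAt_π hU hUF hu i)
    (κ.differentiableAt_π hU hUF hu i)).2 _).trans ?_
  rw [κ.fderiv_π_e hU hUF hu]
  simp [metric]

theorem sum_etaIJ (i : Fin N) : ∑ j, κ.etaIJ i j u = 0 := by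
  rw [← κ.fderiv_etaI_e hU hUF hu i, κ.e_eq_sum_π hUF hu, map_sum]
  rfl

/-- The matrix of `μ` in the frame of the `dv^i`. -/
theorem conj_mu (i j : Fin N) :
    (κ.frame u * F.mu u * κ.coframe u) i j =
      (κ.v i u - κ.v j u) * κ.etaIJ i j u / (2 * κ.etaI j u) := by
  have hf := κ.isFrame hUF hu
  rcases eq_or_ne i j with rfl | hij
  · simp [hf.conj_mu_diag]
  have hne := κ.etaI_ne_zero hUF hu j
  -- Leibniz rule for `E = ∑ v^k π_k`, using `dv^k(π_i) = δ_ik`.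
  have hE : fderiv ℂ F.E u (κ.π i u) =
      κ.π i u + ∑ k, κ.v k u • fderiv ℂ (κ.π k) u (κ.π i u) := by
    have h1 : HasFDerivAt (fun w => ∑ k, κ.v k w • κ.π k w)
        (∑ k, (κ.v k u • fderiv ℂ (κ.π k) u + (fderiv ℂ (κ.v k) u).smulRight (κ.π k u))) u :=
      HasFDerivAt.fun_sum fun k _ => HasFDerivAt.smul
        ((κ.differentiable_v k).differentiableAt (hU.mem_nhds hu)).hasFDerivAt
        (κ.differentiableAt_π hU hUF hu k).hasFDerivAt
    rw [hU.fderiv_congr hu fun w hw => κ.euler w hw, h1.fderiv]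
    simp only [_root_.sum_apply, _root_.add_apply, Finset.sum_add_distrib,
      ContinuousLinearMap.smulRight_apply, κ.dual u hu, _root_.smul_apply]
    simp [add_comm]
  have h1 := hf.conj_mu_apply i j
  have h2 : F.metric u (κ.frame u i ᵥ* F.mu u) (κ.frame u j) =
      -∑ k, κ.v k u * F.metric u (fderiv ℂ (κ.π k) u (κ.π i u)) (κ.π j u) := by
    change F.metric u (κ.π i u ᵥ* F.mu u) (κ.π j u) = _
    have h0 : F.metric u (κ.π i u) (κ.π j u) = 0 := hf.metric_row_of_ne hij
    rw [F.vecMul_mu (hUF hu), hE]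
    simp only [metric_eq_toBilin'] at h0 ⊢
    simp [h0, LinearMap.sum_apply]
  rw [h2] at h1
  -- For `i ≠ j` the Koszul formula leaves only `k = j` and `k = i`, which together produce the
  -- factor `v^i - v^j`.
  have h3 : ∀ k, κ.v k u * F.metric u (fderiv ℂ (κ.π k) u (κ.π i u)) (κ.π j u) =
      (if k = j then κ.v k u * κ.etaIJ k i u / 2 else 0)
        - (if i = k then κ.v k u * κ.etaIJ i j u / 2 else 0) := by
    intro k
    have := κ.metric_fderiv_π hU hUF hu i k j
    rw [if_neg hij] at this
    split_ifs at this ⊢ <;> linear_combination κ.v k u * this / 2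
  simp only [h3, Finset.sum_sub_distrib, Finset.sum_ite_eq, Finset.sum_ite_eq', Finset.mem_univ,
    if_true] at h1
  change _ * κ.etaI j u = _ at h1
  rw [κ.etaIJ_symm hU hUF hu j i] at h1
  rw [eq_div_iff (by simpa using hne)]
  linear_combination 2 * h1

end FrobeniusManifold.CanonicalCoordinates

end

/-! ### Verification of the Virasoro equations for `G` -/

noncomputable section

open Matrix

namespace FrobeniusManifold

variable {N : ℕ} (F : FrobeniusManifold N)

theorem deltaZ_apply (u : Fin N → ℂ) (θ : ℤ → Fin N → ℂ) (j : ℤ) :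
    F.deltaZ u θ j = ((j : ℂ) + 1) • θ (j + 1)
      + (F.mu u + (1 / 2 : ℂ) • (1 : Matrix (Fin N) (Fin N) ℂ)) *ᵥ θ (j + 1)
      + F.calU u *ᵥ θ j := rfl

/-- `δ_z` does not raise the degree. -/
theorem deltaZ_iterate_eq_zero (u : Fin N → ℂ) {θ : ℤ → Fin N → ℂ} {n : ℤ}
    (hθ : ∀ j, n < j → θ j = 0) (m : ℕ) : ∀ j, n < j → (F.deltaZ u)^[m] θ j = 0 := by
  induction m with
  | zero => exact hθ
  | succ m ih =>
    intro j hj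
    rw [Function.iterate_succ_apply', deltaZ_apply, ih j hj, ih (j + 1) (by lia)]
    simp

/-- Both `∂_z` and `z⁻¹ (μ + 1/2)` lower the degree, so only `𝒰` acts on the leading coefficient. -/
theorem deltaZ_iterate_top (u : Fin N → ℂ) {θ : ℤ → Fin N → ℂ} {n : ℤ}
    (hθ : ∀ j, n < j → θ j = 0) (m : ℕ) :
    (F.deltaZ u)^[m] θ n = (F.calU u ^ m) *ᵥ θ n := by
  induction m with
  | zero => simp
  | succ m ih =>
    rw [Function.iterate_succ_apply', deltaZ_apply, ih,
      F.deltaZ_iterate_eq_zero u hθ m (n + 1) (by lia), pow_succ', ← mulVec_mulVec]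
    simp

theorem calX_mul_calU_pow {u : Jet N} (hu : u 0 ∈ F.carrier) (m : ℕ) :
    F.calX u * F.calU (u 0) ^ m = F.calU (u 0) ^ m * F.calX u :=
  (Commute.pow_right (F.contractA_comm hu _ _ : Commute _ _) m).eq

theorem jetPartial_base {g : (Fin N → ℂ) → ℂ} {u : Jet N} (hg : DifferentiableAt ℂ g (u 0))
    (ℓ : ℕ) (a : Fin N) :
    jetPartial ℓ a (fun w => g (w 0)) u = if ℓ = 0 then coordDeriv a g (u 0) else 0 := by
  simp only [jetPartial, lineDeriv]
  split_ifs with h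
  · subst h
    exact (hg.hasFDerivAt.hasLineDerivAt (Pi.single a 1)).lineDeriv
  · have : ∀ t : ℂ, g ((u + t • (Pi.single ℓ (Pi.single a 1 : Fin N → ℂ) : Jet N)) 0) = g (u 0) := by
      intro t
      congr 1
      simp [Pi.single_eq_of_ne (Ne.symm h)]
    simp only [this]
    exact deriv_const _ _

/-- The action of the Virasoro vector fields on functions of the base point. -/
theorem virasoroField_base {g : (Fin N → ℂ) → ℂ} {u : Jet N} (hu : u 0 ∈ F.carrier)
    (hX : (F.calX u).det ≠ 0) (hg : DifferentiableAt ℂ g (u 0)) (m : ℕ) :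
    F.virasoroField m (fun w => g (w 0)) u =
      -(F.e (u 0) ⬝ᵥ (F.calU (u 0) ^ m *ᵥ fun a => coordDeriv a g (u 0))) := by
  have hσ0 : F.sigmaSeries (fun w => g (w 0)) u 0 =
      F.calX u *ᵥ fun a => coordDeriv a g (u 0) := by
    change ∑ᶠ ℓ : ℕ, F.faaDiBruno ℓ 0 u *ᵥ _ = _
    rw [finsum_eq_single _ 0]
    · simp only [jetPartial_base hg]
      rfl
    · intro ℓ hℓ
      simp only [jetPartial_base hg, if_neg hℓ]
      exact mulVec_zero _
  have hσ : ∀ j : ℤ, 0 < j → F.sigmaSeries (fun w => g (w 0)) u j = 0 := by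
    intro j hj
    obtain ⟨k, rfl⟩ := Int.eq_succ_of_zero_lt hj
    change ∑ᶠ ℓ : ℕ, F.faaDiBruno ℓ (k + 1) u *ᵥ _ = _
    refine (finsum_congr fun ℓ => ?_).trans finsum_zero
    rcases ℓ with _ | ℓ
    · exact zero_mulVec _
    · simp only [jetPartial_base hg, if_neg (Nat.succ_ne_zero ℓ)]
      exact mulVec_zero _
  rw [virasoroField, finsum_eq_single _ 0]
  · rw [Nat.cast_zero, F.deltaZ_iterate_top _ hσ, hσ0]
    have hunit : IsUnit (F.calX u).det := isUnit_iff_ne_zero.2 hX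
    -- The factor `𝒳` of `σ` commutes past `𝒰^m` and cancels the inverse in `s_1`.
    rw [sVec, neg_dotProduct, ← dotProduct_mulVec, mulVec_mulVec, mulVec_mulVec,
      mul_assoc, ← F.calX_mul_calU_pow hu, nonsing_inv_mul_cancel_left _ _ hunit]
  · intro j hj
    rw [F.deltaZ_iterate_eq_zero _ hσ m j (by lia), dotProduct_zero]

namespace IsFrame

variable {F} {u : Fin N → ℂ} {P Θ : Matrix (Fin N) (Fin N) ℂ} (h : F.IsFrame u P Θ)
include h

theorem conj_calU_pow (k : ℕ) :
    P * F.calU u ^ k * Θ = diagonal fun i => (F.E u ᵥ* Θ) i ^ k := by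
  rw [h.conj_pow, calU, h.conj_contractA, diagonal_pow]
  rfl

theorem e_dotProduct_mulVec (M : Matrix (Fin N) (Fin N) ℂ) (ξ : Fin N → ℂ) :
    F.e u ⬝ᵥ M *ᵥ ξ = ∑ i, ((P * M * Θ) *ᵥ (P *ᵥ ξ)) i := by
  have h1 : F.e u = (1 : Fin N → ℂ) ᵥ* P := by
    rw [← h.e_vecMul, vecMul_vecMul, h.mul_eq_one', vecMul_one]
  rw [h1, ← dotProduct_mulVec, mulVec_mulVec, mulVec_mulVec, mul_assoc _ Θ, h.mul_eq_one', mul_one]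
  simp [dotProduct]

/-- Multiplication by `π_i` is a projection of rank one, so its trace is `1`. -/
theorem mulVec_socle : P *ᵥ F.socle u = 1 := by
  have h1 : F.socle u = Θ *ᵥ 1 := by
    ext a
    have h2 : F.A u a = contractA (F.A u) (Pi.single a 1) := by
      rw [contractA, Finset.sum_eq_single a]
      · simp
      · intro b _ hb
        simp [hb]
      · simp
    rw [socle, h2, ← h.trace_conj, h.conj_contractA, trace_diagonal]
    simp [mulVec, dotProduct]
  rw [h1, mulVec_mulVec, h.mul_eq_one, one_mulVec]

/-- In the frame `𝒰` is diagonal, and both `e` and `ω` have all components `1`. The geometric sums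
stay unevaluated because eigenvalues of `𝒰` may coincide. -/
theorem genusOneRHS_eq (m : ℕ) :
    F.genusOneRHS m u = ∑ i, ∑ j,
      ((1 / 4 : ℂ) * ((P * F.mu u * Θ) i j * (P * F.mu u * Θ) j i)
          * (∑ ℓ ∈ Finset.range m, (F.E u ᵥ* Θ) j ^ ℓ * (F.E u ᵥ* Θ) i ^ (m - 1 - ℓ))
        + (1 / 24 : ℂ) * (P * F.mu u * Θ) i j
          * (∑ ℓ ∈ Finset.range m, (F.E u ᵥ* Θ) i ^ ℓ * (F.E u ᵥ* Θ) j ^ (m - 1 - ℓ))) := by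
  have hterm : ∀ ℓ, (1 / 4 : ℂ) *
        (F.mu u * F.calU u ^ ℓ * F.mu u * F.calU u ^ (m - 1 - ℓ)).trace
      + (1 / 24 : ℂ) * (F.e u ⬝ᵥ
          (F.calU u ^ ℓ * F.mu u * F.calU u ^ (m - 1 - ℓ)) *ᵥ F.socle u) = ∑ i, ∑ j,
      ((1 / 4 : ℂ) * ((P * F.mu u * Θ) i j * (P * F.mu u * Θ) j i)
          * ((F.E u ᵥ* Θ) j ^ ℓ * (F.E u ᵥ* Θ) i ^ (m - 1 - ℓ))
        + (1 / 24 : ℂ) * (P * F.mu u * Θ) i j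
          * ((F.E u ᵥ* Θ) i ^ ℓ * (F.E u ᵥ* Θ) j ^ (m - 1 - ℓ))) := by
    intro ℓ
    rw [← h.trace_conj, h.e_dotProduct_mulVec, h.mulVec_socle]
    simp only [h.conj_mul, h.conj_calU_pow]
    generalize P * F.mu u * Θ = B
    simp only [Finset.sum_add_distrib]
    congr 1
    · rw [trace, Finset.mul_sum]
      refine Finset.sum_congr rfl fun i _ => ?_
      rw [diag_apply, mul_diagonal, Matrix.mul_apply, Finset.sum_mul, Finset.mul_sum]
      refine Finset.sum_congr rfl fun j _ => ?_
      rw [mul_diagonal]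
      ring
    · simp only [mulVec, dotProduct, mul_diagonal, diagonal_mul, Finset.mul_sum, Pi.one_apply]
      refine Finset.sum_congr rfl fun i _ => Finset.sum_congr rfl fun j _ => ?_
      ring
  rw [genusOneRHS, Finset.sum_congr rfl fun ℓ _ => hterm ℓ, Finset.sum_comm]
  refine Finset.sum_congr rfl fun i _ => ?_
  rw [Finset.sum_comm]
  refine Finset.sum_congr rfl fun j _ => ?_
  rw [Finset.sum_add_distrib, Finset.mul_sum, Finset.mul_sum]

end IsFrame

namespace CanonicalCoordinates

variable {F} {U : Set (Fin N → ℂ)} (κ : F.CanonicalCoordinates U)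
variable (hU : IsOpen U) (hUF : U ⊆ F.carrier) {u : Fin N → ℂ} (hu : u ∈ U)

include hu in
theorem E_vecMul_coframe (i : Fin N) : (F.E u ᵥ* κ.coframe u) i = κ.v i u := by
  rw [vecMul_coframe, κ.euler u hu, map_sum]
  simp [κ.dual u hu]

include hu in
theorem alpha_π (i : Fin N) :
    κ.alpha u (κ.π i u) = ∑ j, (1 / 8 : ℂ) * (κ.v i u - κ.v j u) *
      (κ.etaIJ i j u ^ 2 / (κ.etaI i u * κ.etaI j u)) := by
  simp only [alpha, _root_.sum_apply, _root_.smul_apply, κ.dual u hu]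
  simp

variable {κ} {T : (Fin N → ℂ) → ℂ} {L : Fin N → (Fin N → ℂ) → ℂ}

include hU hu in
theorem hasFDerivAt_genusOneG (hT : κ.IsLogTau T) (hL : κ.IsLogEta L) :
    HasFDerivAt (genusOneG T L)
      (κ.alpha u - (1 / 48 : ℂ) • ∑ i, fderiv ℂ (L i) u) u :=
  (hT u hu).sub ((HasFDerivAt.fun_sum fun i _ =>
    ((hL i).1.differentiableAt (hU.mem_nhds hu)).hasFDerivAt).const_mul _)

include hU hu in
theorem fderiv_logEta (hL : κ.IsLogEta L) (i : Fin N) (x : Fin N → ℂ) :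
    κ.etaI i u * fderiv ℂ (L i) u x = fderiv ℂ (κ.etaI i) u x := by
  have h := ((hL i).1.differentiableAt (hU.mem_nhds hu)).hasFDerivAt.cexp
  rw [← hU.fderiv_congr hu (hL i).2, h.fderiv, ← (hL i).2 u hu]
  simp

include hU hUF hu in
/-- The derivative of the genus one potential along the powers of the Euler vector field. -/
theorem genusOneRHS_eq_fderiv_genusOneG (hT : κ.IsLogTau T) (hL : κ.IsLogEta L) (m : ℕ) :
    F.genusOneRHS m u = -∑ i, κ.v i u ^ m * fderiv ℂ (genusOneG T L) u (κ.π i u) := by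
  have hne := κ.etaI_ne_zero hUF hu
  have hG : ∀ i, fderiv ℂ (genusOneG T L) u (κ.π i u) =
      ∑ j, ((1 / 8 : ℂ) * (κ.v i u - κ.v j u) * (κ.etaIJ i j u ^ 2 / (κ.etaI i u * κ.etaI j u))
        - (1 / 48 : ℂ) * (κ.etaIJ i j u / κ.etaI j u)) := by
    intro i
    rw [(hasFDerivAt_genusOneG hU hu hT hL).fderiv, _root_.sub_apply, κ.alpha_π hu,
      Finset.sum_sub_distrib, ← Finset.mul_sum]
    congr 1
    rw [_root_.smul_apply, _root_.sum_apply, smul_eq_mul]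
    congr 1
    refine Finset.sum_congr rfl fun j _ => ?_
    rw [eq_div_iff (hne j), mul_comm, fderiv_logEta hU hu hL, κ.etaIJ_symm hU hUF hu]
    rfl
  -- Each term carries a factor `v^i - v^j` from `μ`, so the geometric sums are evaluated by
  -- multiplication and coinciding `v^i` do no harm.
  have hgeom : ∀ x y : ℂ, (∑ ℓ ∈ Finset.range m, x ^ ℓ * y ^ (m - 1 - ℓ)) * (x - y) =
      x ^ m - y ^ m := fun x y => (Commute.all x y).geom_sum₂_mul m
  have hterm : ∀ i j, (1 / 4 : ℂ) * ((κ.frame u * F.mu u * κ.coframe u) i j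
          * (κ.frame u * F.mu u * κ.coframe u) j i)
          * (∑ ℓ ∈ Finset.range m, κ.v j u ^ ℓ * κ.v i u ^ (m - 1 - ℓ))
        + (1 / 24 : ℂ) * (κ.frame u * F.mu u * κ.coframe u) i j
          * (∑ ℓ ∈ Finset.range m, κ.v i u ^ ℓ * κ.v j u ^ (m - 1 - ℓ)) =
      (1 / 16 : ℂ) * (κ.v i u - κ.v j u) * (κ.etaIJ i j u ^ 2 / (κ.etaI i u * κ.etaI j u))
          * κ.v j u ^ m
        - (1 / 16 : ℂ) * (κ.v i u - κ.v j u) * (κ.etaIJ i j u ^ 2 / (κ.etaI i u * κ.etaI j u))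
          * κ.v i u ^ m
        + (1 / 48 : ℂ) * (κ.etaIJ i j u / κ.etaI j u) * κ.v i u ^ m
        - (1 / 48 : ℂ) * (κ.v j u ^ m / κ.etaI j u) * κ.etaIJ j i u := by
    intro i j
    have hi := hne i
    have hj := hne j
    rw [κ.conj_mu hU hUF hu, κ.conj_mu hU hUF hu, κ.etaIJ_symm hU hUF hu j i]
    have g1 := hgeom (κ.v i u) (κ.v j u)
    have g2 := hgeom (κ.v j u) (κ.v i u)
    generalize (∑ ℓ ∈ Finset.range m, κ.v j u ^ ℓ * κ.v i u ^ (m - 1 - ℓ)) = S at g2 ⊢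
    generalize (∑ ℓ ∈ Finset.range m, κ.v i u ^ ℓ * κ.v j u ^ (m - 1 - ℓ)) = S' at g1 ⊢
    field_simp
    linear_combination 18432 * (κ.v i u - κ.v j u) * κ.etaIJ i j u ^ 2 * g2
      + 6144 * κ.etaIJ i j u * κ.etaI i u * g1
  rw [(κ.isFrame hUF hu).genusOneRHS_eq]
  simp only [κ.E_vecMul_coframe hu]
  rw [Finset.sum_congr rfl fun i _ => Finset.sum_congr rfl fun j _ => hterm i j]
  simp only [hG, Finset.mul_sum]
  simp only [Finset.sum_sub_distrib, Finset.sum_add_distrib]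
  -- The inner sum over `i` is `e(η_j) = 0`.
  have hz : ∑ i, ∑ j, (1 / 48 : ℂ) * (κ.v j u ^ m / κ.etaI j u) * κ.etaIJ j i u = 0 := by
    rw [Finset.sum_comm]
    refine Finset.sum_eq_zero fun j _ => ?_
    rw [← Finset.mul_sum, κ.sum_etaIJ hU hUF hu, mul_zero]
  -- The summand is antisymmetric up to the choice of power; exchanging `i` and `j` doubles `1/16`
  -- to the `1/8` of `α`.
  have hswap : ∑ i, ∑ j, (1 / 16 : ℂ) * (κ.v i u - κ.v j u) *
        (κ.etaIJ i j u ^ 2 / (κ.etaI i u * κ.etaI j u)) * κ.v j u ^ m =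
      -∑ i, ∑ j, (1 / 16 : ℂ) * (κ.v i u - κ.v j u) *
        (κ.etaIJ i j u ^ 2 / (κ.etaI i u * κ.etaI j u)) * κ.v i u ^ m := by
    rw [Finset.sum_comm, ← Finset.sum_neg_distrib]
    refine Finset.sum_congr rfl fun i _ => ?_
    rw [← Finset.sum_neg_distrib]
    refine Finset.sum_congr rfl fun j _ => ?_
    rw [κ.etaIJ_symm hU hUF hu j i, mul_comm (κ.etaI j u)]
    ring
  rw [hz, hswap, sub_zero]
  simp only [← Finset.sum_neg_distrib, ← Finset.sum_sub_distrib, ← Finset.sum_add_distrib]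
  refine Finset.sum_congr rfl fun i _ => Finset.sum_congr rfl fun j _ => ?_
  ring

include hU hUF in
theorem genusOneVirasoro_genusOneG (hT : κ.IsLogTau T) (hL : κ.IsLogEta L) :
    F.GenusOneVirasoro 0 {w | w 0 ∈ U} (fun w => genusOneG T L (w 0)) := by
  intro m u hu hX
  replace hu : u 0 ∈ U := hu
  have hf := κ.isFrame hUF hu
  have hd := (hasFDerivAt_genusOneG hU hu hT hL).differentiableAt
  refine (F.virasoroField_base (hUF hu) hX hd m).trans ?_
  rw [genusOneRHS_eq_fderiv_genusOneG hU hUF hu hT hL, hf.e_dotProduct_mulVec, hf.conj_calU_pow]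
  congr 1
  refine Finset.sum_congr rfl fun i _ => ?_
  rw [mulVec_diagonal, κ.E_vecMul_coframe hu, fderiv_apply_eq_sum_coordDeriv]
  rfl

end CanonicalCoordinates

end FrobeniusManifold

end

/-! ### The Darboux–Egoroff equations and closedness of `α` -/

noncomputable section

open Matrix

namespace FrobeniusManifold.CanonicalCoordinates

variable {N : ℕ} {F : FrobeniusManifold N} {U : Set (Fin N → ℂ)} (κ : F.CanonicalCoordinates U)
variable (hU : IsOpen U) (hUF : U ⊆ F.carrier) {u : Fin N → ℂ} (hu : u ∈ U)

/-- The coefficients `η_ik / (2 η_i)` of the flat connection in the frame `π`. -/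
def conn (i k : Fin N) (u : Fin N → ℂ) : ℂ := κ.etaIJ i k u / (2 * κ.etaI i u)

/-- The coefficients of the one-form `α` in the coframe `dv^i`. -/
def alphaCoeff (i : Fin N) (u : Fin N → ℂ) : ℂ :=
  ∑ j, (1 / 2 : ℂ) * ((κ.v i u - κ.v j u) * (κ.conn i j u * κ.conn j i u))

include hUF hu in
theorem eq_sum_π (X : Fin N → ℂ) : X = ∑ k, fderiv ℂ (κ.v k) u X • κ.π k u := by
  refine ((κ.isFrame hUF hu).eq_sum X).trans (Finset.sum_congr rfl fun k _ => ?_)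
  rw [κ.vecMul_coframe]
  rfl

include hUF hu in
theorem ext_metric_π {X Y : Fin N → ℂ}
    (h : ∀ j, F.metric u X (κ.π j u) = F.metric u Y (κ.π j u)) : X = Y := by
  have hf := κ.isFrame hUF hu
  refine κ.ext_fderiv_v hUF hu fun l => ?_
  rw [← κ.vecMul_coframe, ← κ.vecMul_coframe]
  refine mul_right_cancel₀ (hf.metric_row_ne_zero l) ?_
  rw [← hf.metric_row_right, ← hf.metric_row_right]
  exact h l

include hU hUF hu

/-- By the Koszul formula the left side is orthogonal to every `π_j` except `π_i` and `π_k`. -/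
theorem fderiv_π_of_ne {i k : Fin N} (hik : i ≠ k) :
    fderiv ℂ (κ.π k) u (κ.π i u) = κ.conn i k u • κ.π i u + κ.conn k i u • κ.π k u := by
  refine κ.ext_metric_π hUF hu fun j => ?_
  have h := κ.metric_fderiv_π hU hUF hu i k j
  have hm : ∀ a, F.metric u (κ.π a u) (κ.π j u) = if a = j then κ.etaI j u else 0 := by
    intro a
    split_ifs with haj
    · subst haj; rfl
    · exact (κ.isFrame hUF hu).metric_row_of_ne haj
  have hr : F.metric u (κ.conn i k u • κ.π i u + κ.conn k i u • κ.π k u) (κ.π j u) =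
      κ.conn i k u * (if i = j then κ.etaI j u else 0)
        + κ.conn k i u * (if k = j then κ.etaI j u else 0) := by
    rw [← hm, ← hm]
    simp [metric_eq_toBilin']
  rw [if_neg hik] at h
  rw [hr]
  have hne := κ.etaI_ne_zero hUF hu
  refine mul_left_cancel₀ (two_ne_zero (α := ℂ)) (h.trans ?_)
  simp only [conn]
  split_ifs with h1 h2 h2
  · exact absurd (h2.trans h1.symm) hik
  · subst h1
    field_simp [hne k]
    ring
  · subst h2
    field_simp [hne i]
    ring
  · simp

theorem differentiableAt_etaIJ (i j : Fin N) : DifferentiableAt ℂ (κ.etaIJ i j) u :=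
  (DifferentiableOn.hasFDerivAt_fderiv_apply (f := κ.etaI i)
    (fun _ hw => (κ.differentiableAt_etaI hU hUF hw i).differentiableWithinAt) hU hu
    (κ.differentiableAt_π hU hUF hu j)).1

/-- The fields `e` and `π_j` commute, so `e(π_j(η_i)) = π_j(e(η_i)) = 0`. -/
theorem fderiv_etaIJ_e (i j : Fin N) : fderiv ℂ (κ.etaIJ i j) u (F.e u) = 0 := by
  have hd : DifferentiableOn ℂ (κ.etaI i) U :=
    fun _ hw => (κ.differentiableAt_etaI hU hUF hw i).differentiableWithinAt
  have h1 := (hd.hasFDerivAt_fderiv_apply hU hu (κ.differentiableAt_π hU hUF hu j)).2 (F.e u)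
  have h2 := (hd.hasFDerivAt_fderiv_apply hU hu
    (F.hasFDerivAt_e (hUF hu)).differentiableAt).2 (κ.π j u)
  rw [hU.fderiv_congr (f := fun w => fderiv ℂ (κ.etaI i) w (F.e w)) (g := fun _ => 0) hu
    fun w hw => κ.fderiv_etaI_e hU hUF hw i, (F.hasFDerivAt_e (hUF hu)).fderiv] at h2
  rw [hd.fderiv_fderiv_comm hU hu, κ.fderiv_π_e hU hUF hu, map_zero, add_zero] at h1
  refine h1.trans ?_
  simpa using h2.symm

theorem hasFDerivAt_conn (i k : Fin N) :
    HasFDerivAt (κ.conn i k) (fderiv ℂ (κ.conn i k) u) u := by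
  have hne := κ.etaI_ne_zero hUF hu i
  have h : κ.conn i k = fun w => κ.etaIJ i k w * (2 * κ.etaI i w)⁻¹ :=
    funext fun w => div_eq_mul_inv _ _
  refine DifferentiableAt.hasFDerivAt ?_
  rw [h]
  exact (κ.differentiableAt_etaIJ hU hUF hu i k).mul
    (((κ.differentiableAt_etaI hU hUF hu i).const_mul 2).inv (by simpa using hne))

theorem fderiv_conn_e (i k : Fin N) : fderiv ℂ (κ.conn i k) u (F.e u) = 0 := by
  have hne := κ.etaI_ne_zero hUF hu i
  have h : HasFDerivAt (fun w => κ.conn i k w * (2 * κ.etaI i w)) _ u :=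
    (κ.hasFDerivAt_conn hU hUF hu i k).mul
      ((κ.differentiableAt_etaI hU hUF hu i).hasFDerivAt.const_mul 2)
  have h1 := h.fderiv
  rw [hU.fderiv_congr (f := fun w => κ.conn i k w * (2 * κ.etaI i w)) (g := κ.etaIJ i k) hu fun w hw => div_mul_cancel₀ _
    (by simpa using κ.etaI_ne_zero hUF hw i)] at h1
  have h2 := congrArg (fun L : (Fin N → ℂ) →L[ℂ] ℂ => L (F.e u)) h1
  simp only [κ.fderiv_etaIJ_e hU hUF hu, _root_.add_apply, _root_.smul_apply,
    κ.fderiv_etaI_e hU hUF hu, smul_eq_mul, mul_zero, zero_add] at h2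
  exact (mul_eq_zero.1 h2.symm).resolve_left (by simpa using hne)

/-- The Darboux–Egoroff equations. -/
theorem fderiv_conn_π {i k l : Fin N} (hik : i ≠ k) (hil : i ≠ l) (hkl : k ≠ l) :
    fderiv ℂ (κ.conn i k) u (κ.π l u) = κ.conn i l u * κ.conn l k u
      + κ.conn k l u * κ.conn i k u - κ.conn i k u * κ.conn i l u := by
  have hV : ∀ {a b : Fin N}, a ≠ b → ∀ c x,
      fderiv ℂ (fun w => fderiv ℂ (κ.π b) w (κ.π a w)) u (κ.π x u) =
      (κ.conn a b u • fderiv ℂ (κ.π a) u (κ.π x u)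
          + fderiv ℂ (κ.conn a b) u (κ.π x u) • κ.π a u)
        + (κ.conn b a u • fderiv ℂ (κ.π b) u (κ.π x u)
          + fderiv ℂ (κ.conn b a) u (κ.π x u) • κ.π b u) ∧
      fderiv ℂ (κ.v c) u (fderiv ℂ (κ.π b) u (κ.π a u)) =
        κ.conn a b u * (if c = a then 1 else 0) + κ.conn b a u * (if c = b then 1 else 0) := by
    intro a b hab c x
    constructor
    · have h : HasFDerivAt (fun w => κ.conn a b w • κ.π a w + κ.conn b a w • κ.π b w) _ u :=
        ((κ.hasFDerivAt_conn hU hUF hu a b).smul (κ.differentiableAt_π hU hUF hu a).hasFDerivAt).add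
          ((κ.hasFDerivAt_conn hU hUF hu b a).smul (κ.differentiableAt_π hU hUF hu b).hasFDerivAt)
      rw [hU.fderiv_congr hu fun w hw => κ.fderiv_π_of_ne hU hUF hw hab, h.fderiv]
      simp
    · rw [κ.fderiv_π_of_ne hU hUF hu hab]
      simp [κ.dual u hu]
  -- Flatness is the symmetry of the second derivatives of `π_k`. Since `[π_l, π_i] = 0`,
  -- differentiating `∇_{π_i} π_k` along `π_l` agrees with the reverse order; the equation is the
  -- `dv^i` component.
  have hd := κ.differentiableOn_π hU hUF k
  have h1 := (hd.hasFDerivAt_fderiv_apply hU hu (κ.differentiableAt_π hU hUF hu i)).2 (κ.π l u)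
  have h2 := (hd.hasFDerivAt_fderiv_apply hU hu (κ.differentiableAt_π hU hUF hu l)).2 (κ.π i u)
  rw [hd.fderiv_fderiv_comm hU hu, κ.fderiv_π_comm hU hUF hu l i, ← h2, (hV hik i l).1,
    (hV (Ne.symm hkl) i i).1] at h1
  have h3 := congrArg (fderiv ℂ (κ.v i) u) h1
  simp only [map_add, map_smul, smul_eq_mul, κ.dual u hu, (hV (Ne.symm hil) i i).2,
    (hV (Ne.symm hkl) i i).2, (hV hil i i).2, (hV hik i i).2, if_neg hik, if_neg hil, if_true] at h3
  linear_combination h3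

theorem fderiv_conn_mul_conn (i k : Fin N) (x : Fin N → ℂ) :
    fderiv ℂ (fun w => κ.conn i k w * κ.conn k i w) u x =
      κ.conn i k u * fderiv ℂ (κ.conn k i) u x + κ.conn k i u * fderiv ℂ (κ.conn i k) u x := by
  have h : HasFDerivAt (fun w => κ.conn i k w * κ.conn k i w) _ u :=
    (κ.hasFDerivAt_conn hU hUF hu i k).mul (κ.hasFDerivAt_conn hU hUF hu k i)
  rw [h.fderiv]
  rfl

/-- Writing `γ` for `conn`, the Darboux–Egoroff equations give `γ_ij γ_jk γ_ki + γ_ji γ_ik γ_kj`,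
symmetric in the three indices. -/
theorem fderiv_conn_mul_conn_comm {i j k : Fin N} (hij : i ≠ j) (hik : i ≠ k) (hjk : j ≠ k) :
    fderiv ℂ (fun w => κ.conn i j w * κ.conn j i w) u (κ.π k u) =
      fderiv ℂ (fun w => κ.conn i k w * κ.conn k i w) u (κ.π j u) := by
  rw [κ.fderiv_conn_mul_conn hU hUF hu, κ.fderiv_conn_mul_conn hU hUF hu,
    κ.fderiv_conn_π hU hUF hu hij hik hjk, κ.fderiv_conn_π hU hUF hu hij.symm hjk hik,
    κ.fderiv_conn_π hU hUF hu hik hij hjk.symm, κ.fderiv_conn_π hU hUF hu hik.symm hjk.symm hij]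
  ring

theorem hasFDerivAt_alphaCoeff (i : Fin N) :
    DifferentiableAt ℂ (κ.alphaCoeff i) u ∧ ∀ x, fderiv ℂ (κ.alphaCoeff i) u x =
      ∑ j, (1 / 2 : ℂ) * ((κ.v i u - κ.v j u)
          * fderiv ℂ (fun w => κ.conn i j w * κ.conn j i w) u x
        + κ.conn i j u * κ.conn j i u * (fderiv ℂ (κ.v i) u x - fderiv ℂ (κ.v j) u x)) := by
  have hv := fun i => ((κ.differentiable_v i).differentiableAt (hU.mem_nhds hu)).hasFDerivAt
  have hp : ∀ j, HasFDerivAt (fun w => κ.conn i j w * κ.conn j i w)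
      (fderiv ℂ (fun w => κ.conn i j w * κ.conn j i w) u) u := fun j =>
    ((κ.hasFDerivAt_conn hU hUF hu i j).mul
      (κ.hasFDerivAt_conn hU hUF hu j i)).differentiableAt.hasFDerivAt
  have h : HasFDerivAt (κ.alphaCoeff i) _ u := HasFDerivAt.fun_sum fun j _ =>
    (((hv i).sub (hv j)).mul (hp j)).const_mul (1 / 2 : ℂ)
  refine ⟨h.differentiableAt, fun x => ?_⟩
  rw [h.fderiv]
  simp only [_root_.sum_apply, _root_.add_apply, _root_.smul_apply, _root_.sub_apply, smul_eq_mul]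
  rfl

/-- With `H_ij = γ_ij γ_ji`, symmetry of `π_k(H_ij)` turns the difference into `(v^i - v^k)/2` times
`∑_j π_j(H_ik) = e(H_ik) = 0`. The terms from differentiating the `v^i` cancel. -/
theorem fderiv_alphaCoeff_comm (i k : Fin N) :
    fderiv ℂ (κ.alphaCoeff i) u (κ.π k u) = fderiv ℂ (κ.alphaCoeff k) u (κ.π i u) := by
  rcases eq_or_ne i k with rfl | hik
  · rfl
  rw [(κ.hasFDerivAt_alphaCoeff hU hUF hu i).2, (κ.hasFDerivAt_alphaCoeff hU hUF hu k).2,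
    ← sub_eq_zero, ← Finset.sum_sub_distrib]
  have hcomm : ∀ a b : Fin N, (fun w => κ.conn a b w * κ.conn b a w) =
      fun w => κ.conn b a w * κ.conn a b w := fun a b => funext fun w => mul_comm _ _
  have hsum : ∑ j, fderiv ℂ (fun w => κ.conn i k w * κ.conn k i w) u (κ.π j u) = 0 := by
    rw [← map_sum, ← κ.e_eq_sum_π hUF hu, κ.fderiv_conn_mul_conn hU hUF hu,
      κ.fderiv_conn_e hU hUF hu, κ.fderiv_conn_e hU hUF hu]
    ring
  have hterm : ∀ j, (1 / 2 : ℂ) * ((κ.v i u - κ.v j u)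
          * fderiv ℂ (fun w => κ.conn i j w * κ.conn j i w) u (κ.π k u)
        + κ.conn i j u * κ.conn j i u
          * (fderiv ℂ (κ.v i) u (κ.π k u) - fderiv ℂ (κ.v j) u (κ.π k u)))
      - (1 / 2 : ℂ) * ((κ.v k u - κ.v j u)
          * fderiv ℂ (fun w => κ.conn k j w * κ.conn j k w) u (κ.π i u)
        + κ.conn k j u * κ.conn j k u
          * (fderiv ℂ (κ.v k) u (κ.π i u) - fderiv ℂ (κ.v j) u (κ.π i u))) =
      (1 / 2 : ℂ) * (κ.v i u - κ.v k u)
          * fderiv ℂ (fun w => κ.conn i k w * κ.conn k i w) u (κ.π j u)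
        + ((1 / 2 : ℂ) * κ.conn i k u * κ.conn k i u * (if i = j then 1 else 0)
        - (1 / 2 : ℂ) * κ.conn i k u * κ.conn k i u * (if k = j then 1 else 0)) := by
    intro j
    simp only [κ.dual u hu, if_neg hik, if_neg hik.symm]
    rcases eq_or_ne j i with rfl | hji
    · rw [hcomm k j]
      simp only [if_true, if_neg hik, if_neg hik.symm]
      ring
    rcases eq_or_ne j k with rfl | hjk
    · simp only [if_true, if_neg hik, if_neg hik.symm]
      ring
    rw [κ.fderiv_conn_mul_conn_comm hU hUF hu hji.symm hik hjk,
      κ.fderiv_conn_mul_conn_comm hU hUF hu hjk.symm hik.symm hji, hcomm k i]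
    simp only [if_neg hji, if_neg hjk, if_neg hji.symm, if_neg hjk.symm]
    ring
  rw [Finset.sum_congr rfl fun j _ => hterm j, Finset.sum_add_distrib, ← Finset.mul_sum, hsum,
    Finset.sum_sub_distrib, ← Finset.mul_sum, ← Finset.mul_sum]
  simp

theorem alpha_eq : κ.alpha u = ∑ i, κ.alphaCoeff i u • fderiv ℂ (κ.v i) u := by
  have hne := κ.etaI_ne_zero hUF hu
  refine Finset.sum_congr rfl fun i _ => ?_
  rw [← Finset.sum_smul]
  congr 1
  refine Finset.sum_congr rfl fun j _ => ?_
  have hi := hne i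
  have hj := hne j
  rw [conn, conn, κ.etaIJ_symm hU hUF hu j i]
  field_simp
  ring

theorem differentiableAt_alpha : DifferentiableAt ℂ κ.alpha u ∧
    ∀ x y, fderiv ℂ κ.alpha u x y = fderiv ℂ κ.alpha u y x := by
  have hdv := fun i => (((κ.differentiable_v i).fderiv_of_isOpen hU).differentiableAt
    (hU.mem_nhds hu)).hasFDerivAt
  have h : HasFDerivAt (fun w => ∑ i, κ.alphaCoeff i w • fderiv ℂ (κ.v i) w)
      (∑ i, (κ.alphaCoeff i u • fderiv ℂ (fderiv ℂ (κ.v i)) u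
        + (fderiv ℂ (κ.alphaCoeff i) u).smulRight (fderiv ℂ (κ.v i) u))) u :=
    HasFDerivAt.fun_sum fun i _ =>
      HasFDerivAt.smul (κ.hasFDerivAt_alphaCoeff hU hUF hu i).1.hasFDerivAt (hdv i)
  have heq : κ.alpha =ᶠ[nhds u] fun w => ∑ i, κ.alphaCoeff i w • fderiv ℂ (κ.v i) w :=
    Filter.eventually_of_mem (hU.mem_nhds hu) fun w hw => κ.alpha_eq hU hUF hw
  have h' := h.congr_of_eventuallyEq heq
  refine ⟨h'.differentiableAt, fun x y => ?_⟩
  have hexp : ∀ i x, fderiv ℂ (κ.alphaCoeff i) u x =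
      ∑ k, fderiv ℂ (κ.v k) u x * fderiv ℂ (κ.alphaCoeff i) u (κ.π k u) := by
    intro i x
    conv_lhs => rw [κ.eq_sum_π hUF hu x]
    simp [map_sum]
  rw [h'.fderiv]
  simp only [_root_.sum_apply, _root_.add_apply, _root_.smul_apply,
    ContinuousLinearMap.smulRight_apply, smul_eq_mul, Finset.sum_add_distrib]
  congr 1
  · refine Finset.sum_congr rfl fun i _ => ?_
    rw [(κ.differentiable_v i).fderiv_fderiv_comm hU hu]
  · simp only [hexp _ x, hexp _ y, Finset.sum_mul]
    rw [Finset.sum_comm]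
    refine Finset.sum_congr rfl fun i _ => Finset.sum_congr rfl fun k _ => ?_
    rw [κ.fderiv_alphaCoeff_comm hU hUF hu i k]
    ring

end FrobeniusManifold.CanonicalCoordinates

end

/-! ### Semisimple tangent algebras and the idempotent equation -/

noncomputable section

open Matrix

namespace FrobeniusManifold

variable {N : ℕ} (F : FrobeniusManifold N)

instance (u : F.carrier) : Module ℂ (F.TangentAlgebra u) :=
  inferInstanceAs (Module ℂ (Fin N → ℂ))

instance (u : F.carrier) : Module.Finite ℂ (F.TangentAlgebra u) :=
  inferInstanceAs (Module.Finite ℂ (Fin N → ℂ))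

theorem finrank_tangentAlgebra (u : F.carrier) :
    Module.finrank ℂ (F.TangentAlgebra u) = N := Module.finrank_fin_fun ℂ

theorem mul_smul_vec (u : Fin N → ℂ) (c : ℂ) (X Y : Fin N → ℂ) :
    F.mul u X (c • Y) = c • F.mul u X Y := by
  simp only [mul, tangentMul, smul_vecMul]

theorem smul_mul_vec {u : Fin N → ℂ} (hu : u ∈ F.carrier) (c : ℂ) (X Y : Fin N → ℂ) :
    F.mul u (c • X) Y = c • F.mul u X Y := by
  rw [F.mul_comm_of_mem hu, F.mul_smul_vec, F.mul_comm_of_mem hu]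

instance (u : F.carrier) : Algebra ℂ (F.TangentAlgebra u) :=
  Algebra.ofModule (fun c X Y => F.smul_mul_vec u.2 c X Y) (fun c X Y => F.mul_smul_vec u.1 c X Y)

/-- A commutative semisimple complex algebra of finite dimension is a power of `ℂ`. -/
theorem _root_.IsSemisimpleRing.exists_algEquiv_pi_complex (R : Type*) [CommRing R] [Algebra ℂ R]
    [Module.Finite ℂ R] [IsSemisimpleRing R] :
    ∃ n : ℕ, Nonempty (R ≃ₐ[ℂ] (Fin n → ℂ)) := by
  obtain ⟨n, d, hd, ⟨e⟩⟩ := IsSemisimpleRing.exists_algEquiv_pi_matrix_of_isAlgClosed ℂ R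
  have hcomm : ∀ x y : ∀ i, Matrix (Fin (d i)) (Fin (d i)) ℂ, x * y = y * x := fun x y =>
    e.symm.injective (by rw [map_mul, map_mul, mul_comm])
  -- A block of size at least two contains the noncommuting matrix units `E_ab`, `E_ba`, contrary to
  -- commutativity.
  have hsub : ∀ i, Subsingleton (Fin (d i)) := by
    refine fun i => ⟨fun a b => ?_⟩
    by_contra hab
    have h := congrFun (hcomm (Pi.single i (Matrix.single a b 1))
      (Pi.single i (Matrix.single b a 1))) i
    simp only [Pi.mul_apply, Pi.single_eq_same, Matrix.single_mul_single_same] at h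
    have h' := congrFun (congrFun h a) a
    simp [Ne.symm hab] at h'
  let ε : ∀ i, Matrix (Fin (d i)) (Fin (d i)) ℂ ≃ₐ[ℂ] ℂ := fun i =>
    { toFun := fun M => M 0 0
      invFun := fun c => of fun _ _ => c
      left_inv := fun M => by
        ext a b
        rw [Subsingleton.elim a 0, Subsingleton.elim b 0]
        rfl
      right_inv := fun c => rfl
      map_mul' := fun M M' => by rw [Matrix.mul_apply, Fintype.sum_subsingleton _ 0]
      map_add' := fun M M' => rfl
      commutes' := fun c => by simp [Matrix.algebraMap_matrix_apply] }
  exact ⟨n, ⟨e.trans (AlgEquiv.piCongrRight ε)⟩⟩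

theorem exists_isFrame_of_mem_semisimpleLocus {p : Fin N → ℂ} (hp : p ∈ F.semisimpleLocus) :
    ∃ P Θ, F.IsFrame p P Θ := by
  obtain ⟨hpc, hss⟩ := hp
  obtain ⟨n, ⟨e⟩⟩ := IsSemisimpleRing.exists_algEquiv_pi_complex (F.TangentAlgebra ⟨p, hpc⟩)
  have hn : N = n := by
    have := e.toLinearEquiv.finrank_eq
    rwa [F.finrank_tangentAlgebra, Module.finrank_fin_fun] at this
  subst hn
  -- The identity map, changing only the type so that the algebra isomorphism applies to plain
  -- vectors. The frame consists of the preimages of the standard idempotents of `ℂ^N`.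
  let ι : (Fin N → ℂ) →ₗ[ℂ] F.TangentAlgebra ⟨p, hpc⟩ := LinearMap.id (M := Fin N → ℂ)
  refine ⟨of fun i => (e.symm (Pi.single i 1) : F.TangentAlgebra ⟨p, hpc⟩),
    of fun b j => e (ι (Pi.single b 1)) j, hpc, ?_, fun i j => ?_⟩
  · ext i j
    have h1 : ∀ X : Fin N → ℂ, ∑ b, X b * e (ι (Pi.single b 1)) j = e (ι X) j := by
      intro X
      conv_rhs => rw [pi_eq_sum_univ' X]
      simp [map_sum]
    rw [Matrix.mul_apply]
    refine (h1 _).trans ?_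
    change e (e.symm (Pi.single i 1)) j = _
    rw [e.apply_symm_apply, Matrix.one_apply, Pi.single_apply]
    simp [eq_comm]
  · change (e.symm (Pi.single i 1) * e.symm (Pi.single j 1) : F.TangentAlgebra ⟨p, hpc⟩) = _
    rw [← map_mul, ← Pi.single_mul_left]
    split_ifs with hij
    · subst hij
      simp
      rfl
    · rw [Pi.single_eq_of_ne hij]
      simp
      rfl

theorem IsFrame.mem_semisimpleLocus {F : FrobeniusManifold N} {u : Fin N → ℂ}
    {P Θ : Matrix (Fin N) (Fin N) ℂ} (h : F.IsFrame u P Θ) : u ∈ F.semisimpleLocus := by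
  refine ⟨h.mem, ?_⟩
  let e : (Fin N → ℂ) ≃+* F.TangentAlgebra ⟨u, h.mem⟩ :=
    { toFun := fun y => (y ᵥ* P : Fin N → ℂ)
      invFun := fun x : Fin N → ℂ => x ᵥ* Θ
      left_inv := fun y => by
        change (y ᵥ* P) ᵥ* Θ = y
        rw [vecMul_vecMul, h.mul_eq_one, vecMul_one]
      right_inv := fun x => by
        have hx : ∀ x : Fin N → ℂ, x ᵥ* Θ ᵥ* P = x := fun x => by
          rw [vecMul_vecMul, h.mul_eq_one', vecMul_one]
        exact hx x
      map_add' := fun x y => add_vecMul P x y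
      map_mul' := fun x y => by
        change (x * y) ᵥ* P = (y ᵥ* P) ᵥ* contractA (F.A u) (x ᵥ* P)
        rw [h.contractA_eq, vecMul_vecMul, vecMul_vecMul, h.mul_eq_one, vecMul_one, mul_assoc,
          ← mul_assoc P, h.mul_eq_one, one_mul, ← vecMul_vecMul]
        congr 1
        ext i
        rw [vecMul_diagonal, Pi.mul_apply, mul_comm] }
  exact e.isSemisimpleRing

/-- The idempotent equation for tangent vectors. -/
def idemEq (z : (Fin N → ℂ) × (Fin N → ℂ)) : Fin N → ℂ := F.mul z.1 z.2 z.2 - z.2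

theorem contDiffAt_idemEq {p x : Fin N → ℂ} (hp : p ∈ F.carrier) :
    ContDiffAt ℂ 1 F.idemEq (p, x) := by
  refine contDiffAt_pi.2 fun c => ?_
  have hA : ∀ a b, ContDiffAt ℂ 1 (fun z : (Fin N → ℂ) × (Fin N → ℂ) => F.A z.1 a b c) (p, x) :=
    fun a b => ContDiffAt.comp (p, x) (f := Prod.fst) (g := fun u => F.A u a b c)
      (((F.differentiable_A a b c).contDiffOn_nat_of_isOpen F.isOpen_carrier 1).contDiffAt
        (F.mem_nhds_carrier hp)) contDiffAt_fst
  have hx : ∀ a, ContDiffAt ℂ 1 (fun z : (Fin N → ℂ) × (Fin N → ℂ) => z.2 a) (p, x) :=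
    fun a => contDiffAt_pi.1 contDiffAt_snd a
  simp only [idemEq, Pi.sub_apply, mul_apply]
  exact (ContDiffAt.sum fun b _ => ContDiffAt.sum fun a _ =>
    (hx b).mul ((hx a).mul (hA a b))).sub (hx c)

/-- The derivative of `y ∘ y - y` at an idempotent `x` is `D = 2 x∘ - 1`, and `D² = 1`. -/
theorem isInvertible_fderiv_idemEq {p x : Fin N → ℂ} (hp : p ∈ F.carrier)
    (hx : F.mul p x x = x) :
    (fderiv ℂ F.idemEq (p, x) ∘L .inr ℂ (Fin N → ℂ) (Fin N → ℂ)).IsInvertible := by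
  set D := fderiv ℂ F.idemEq (p, x) ∘L .inr ℂ (Fin N → ℂ) (Fin N → ℂ) with hD
  have h1 : HasFDerivAt (fun y => F.idemEq (p, y)) D x :=
    ((F.contDiffAt_idemEq hp).differentiableAt (by simp)).hasFDerivAt.comp x
      (hasFDerivAt_prodMk_right p x)
  let M : (Fin N → ℂ) →L[ℂ] (Fin N → ℂ) →L[ℂ] (Fin N → ℂ) :=
    LinearMap.toContinuousLinearMap ((LinearMap.toContinuousLinearMap).toLinearMap ∘ₗ
      LinearMap.mk₂ ℂ (F.mul p) (F.add_mul_of_mem hp) (F.smul_mul_vec hp) (F.mul_add_vec p)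
        (fun c X Y => F.mul_smul_vec p c X Y))
  have hM : ∀ X Y, M X Y = F.mul p X Y := fun X Y => rfl
  have h2 : HasFDerivAt (fun y => M y y - y) (M x + M.flip x - ContinuousLinearMap.id ℂ _) x := by
    have := (M.hasFDerivAt (x := x)).clm_apply (hasFDerivAt_id x)
    simpa using! this.sub (hasFDerivAt_id x)
  have hDe : ∀ Y, D Y = F.mul p x Y + F.mul p x Y - Y := by
    intro Y
    rw [h1.unique h2]
    simp [hM, F.mul_comm_of_mem hp Y x]
  have hDD : D ∘L D = ContinuousLinearMap.id ℂ _ := by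
    refine ContinuousLinearMap.ext fun Y => ?_
    have hxx : F.mul p x (F.mul p x Y) = F.mul p x Y := by
      rw [← F.mul_assoc_of_mem hp, hx]
    change D (D Y) = Y
    rw [hDe (D Y), hDe Y]
    simp only [← hM, map_add, map_sub] at hxx ⊢
    rw [hxx]
    abel
  exact ContinuousLinearMap.IsInvertible.of_inverse hDD hDD

end FrobeniusManifold

end

/-! ### Existence of canonical coordinates and of `log τ_I` -/

noncomputable section

open Matrix

namespace FrobeniusManifold

variable {N : ℕ} (F : FrobeniusManifold N)

/-- An idempotent tangent vector extends to a local holomorphic field of idempotents, which is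
locally unique. -/
theorem exists_idempotent_extension {p x : Fin N → ℂ} (hp : p ∈ F.carrier)
    (hx : F.mul p x x = x) :
    ∃ ψ : (Fin N → ℂ) → Fin N → ℂ, ψ p = x ∧ (∀ᶠ w in nhds p, DifferentiableAt ℂ ψ w) ∧
      (∀ᶠ w in nhds p, F.mul w (ψ w) (ψ w) = ψ w) ∧
      ∀ᶠ z in nhds (p, x), F.mul z.1 z.2 z.2 = z.2 → ψ z.1 = z.2 := by
  have hc := F.contDiffAt_idemEq (x := x) hp
  have hi := F.isInvertible_fderiv_idemEq hp hx
  have h0 : F.idemEq (p, x) = 0 := sub_eq_zero.2 hx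
  refine ⟨hc.implicitFunction one_ne_zero hi, hc.implicitFunction_apply_self one_ne_zero hi, ?_,
    ?_, ?_⟩
  · filter_upwards [(hc.contDiffAt_implicitFunction one_ne_zero hi).eventually (by simp)] with w hw
    exact hw.differentiableAt (by simp)
  · filter_upwards [hc.eventually_apply_implicitFunction one_ne_zero hi] with w hw
    exact sub_eq_zero.1 (hw.trans h0)
  · filter_upwards [hc.eventually_apply_eq_iff_implicitFunction one_ne_zero hi] with z hz hzz
    exact hz.1 ((sub_eq_zero.2 hzz).trans h0.symm)

theorem tendsto_mul {p : Fin N → ℂ} (hp : p ∈ F.carrier) {X Y : (Fin N → ℂ) → Fin N → ℂ}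
    (hX : ContinuousAt X p) (hY : ContinuousAt Y p) :
    ContinuousAt (fun w => F.mul w (X w) (Y w)) p := by
  refine continuousAt_pi.2 fun c => ?_
  simp only [mul_apply]
  exact tendsto_finsetSum _ fun b _ => tendsto_finsetSum _ fun a _ =>
    (continuousAt_pi.1 hY b).mul
      ((continuousAt_pi.1 hX a).mul (F.differentiableAt_A hp a b c).continuousAt)

/-- Near a semisimple point there is a holomorphic frame of orthogonal idempotents. -/
theorem exists_frameField {p : Fin N → ℂ} (hp : p ∈ F.semisimpleLocus) :
    ∃ r > 0, ∃ π : Fin N → (Fin N → ℂ) → Fin N → ℂ, ∀ w ∈ Metric.ball p r,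
      (∀ i, DifferentiableAt ℂ (π i) w) ∧
        F.IsFrame w (of fun i b => π i w b) (of fun i b => π i w b)⁻¹ := by
  obtain ⟨P, Θ, h⟩ := F.exists_isFrame_of_mem_semisimpleLocus hp
  have hpc := h.mem
  have hidem : ∀ i, F.mul p (P i) (P i) = P i := fun i => by rw [h.idem, if_pos rfl]
  choose π hπp hπd hπi _ using fun i => F.exists_idempotent_extension hpc (hidem i)
  have hcont : ∀ i, ContinuousAt (π i) p := fun i => (hπd i).self_of_nhds.continuousAt
  -- Local uniqueness at the idempotent `0`: the products `π_i ∘ π_j` with `i ≠ j` are idempotent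
  -- fields vanishing at `p`, hence equal to the zero field nearby.
  obtain ⟨ψ, -, -, -, hψ⟩ := F.exists_idempotent_extension hpc (F.mul_zero_vec p 0)
  have horth : ∀ i j, i ≠ j → ∀ᶠ w in nhds p, F.mul w (π i w) (π j w) = 0 := by
    intro i j hij
    have h0 : F.mul p (π i p) (π j p) = 0 := by rw [hπp, hπp, h.idem, if_neg hij]
    have ht : Filter.Tendsto (fun w => (w, F.mul w (π i w) (π j w))) (nhds p) (nhds (p, 0)) := by
      have := continuousAt_id.prodMk (F.tendsto_mul hpc (hcont i) (hcont j))
      rw [ContinuousAt, h0] at this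
      exact this
    have ht0 : Filter.Tendsto (fun w : Fin N → ℂ => (w, (0 : Fin N → ℂ))) (nhds p)
        (nhds (p, 0)) := (continuousAt_id.prodMk continuousAt_const : ContinuousAt _ p)
    filter_upwards [ht.eventually hψ, ht0.eventually hψ, hπi i, hπi j,
      F.mem_nhds_carrier hpc] with w h1 h2 hi hj hw
    rw [← h1, h2 (F.mul_zero_vec w 0)]
    have e : F.mul w (π j w) (F.mul w (π i w) (π j w)) = F.mul w (π i w) (π j w) := by
      rw [F.mul_comm_of_mem hw (π i w), ← F.mul_assoc_of_mem hw, hj]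
    rw [F.mul_assoc_of_mem hw (π i w) (π j w), e, ← F.mul_assoc_of_mem hw, hi]
  have hdet : ∀ᶠ w in nhds p, (of fun i b => π i w b : Matrix (Fin N) (Fin N) ℂ).det ≠ 0 := by
    have hc : ContinuousAt (fun w => (of fun i b => π i w b : Matrix (Fin N) (Fin N) ℂ).det) p := by
      have : ContinuousAt (fun w => (of fun i b => π i w b : Matrix (Fin N) (Fin N) ℂ)) p :=
        continuousAt_pi.2 fun i => hcont i
      exact ContinuousAt.comp (g := Matrix.det) (continuous_id.matrix_det.continuousAt) this
    refine hc.eventually_ne ?_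
    have hP : (of fun i b => π i p b : Matrix (Fin N) (Fin N) ℂ) = P := by
      ext i b
      simp [hπp]
    rw [hP]
    intro h0
    have := congrArg Matrix.det h.mul_eq_one
    rw [det_mul, h0] at this
    simp at this
  have hall : ∀ᶠ w in nhds p, (w ∈ F.carrier ∧ (∀ i, DifferentiableAt ℂ (π i) w) ∧
      (∀ i, F.mul w (π i w) (π i w) = π i w) ∧ (∀ i j, i ≠ j → F.mul w (π i w) (π j w) = 0)) ∧
      (of fun i b => π i w b : Matrix (Fin N) (Fin N) ℂ).det ≠ 0 := by
    refine Filter.Eventually.and ((F.isOpen_carrier.eventually_mem hpc).and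
      ((Filter.eventually_all.2 hπd).and ((Filter.eventually_all.2 hπi).and ?_))) hdet
    refine Filter.eventually_all.2 fun i => Filter.eventually_all.2 fun j => ?_
    by_cases hij : i = j
    · simp [hij]
    · simpa [hij] using horth i j hij
  obtain ⟨r, hr, hball⟩ := Metric.eventually_nhds_iff_ball.1 hall
  refine ⟨r, hr, π, fun w hw => ?_⟩
  obtain ⟨⟨hwc, hd, hi, ho⟩, hdet⟩ := hball w hw
  refine ⟨hd, hwc, mul_nonsing_inv _ (isUnit_iff_ne_zero.2 hdet), fun i j => ?_⟩
  split_ifs with hij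
  · subst hij
    exact hi i
  · exact ho i j hij

theorem A_eq_contractA (u : Fin N → ℂ) (a : Fin N) :
    F.A u a = contractA (F.A u) (Pi.single a 1) := by
  rw [contractA, Finset.sum_eq_single a]
  · simp
  · intro b _ hb
    simp [hb]
  · simp

variable {F}

/-- Put `Z = [E, X]`. The Euler identity for `X ∘ X = X` reads `Z = 2 Z ∘ X + X`; multiplying by `X`
gives `Z ∘ X = -X`, whence `Z = -X`. -/
theorem IsFrame.lieBracket_E {B : Set (Fin N → ℂ)} (hB : IsOpen B) {X : (Fin N → ℂ) → Fin N → ℂ}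
    {u : Fin N → ℂ} (hu : u ∈ B) (huc : u ∈ F.carrier) (hX : DifferentiableAt ℂ X u)
    (hidem : ∀ w ∈ B, F.mul w (X w) (X w) = X w) :
    VectorField.lieBracket ℂ F.E X u = -X u := by
  have h1 := F.lieBracket_E_mul huc hX hX
  have h2 : VectorField.lieBracket ℂ F.E (fun w => F.mul w (X w) (X w)) u =
      VectorField.lieBracket ℂ F.E X u := by
    simp only [VectorField.lieBracket_eq, hidem u hu, hB.fderiv_congr hu hidem]
  rw [h2, F.mul_comm_of_mem huc (X u) (VectorField.lieBracket ℂ F.E X u), hidem u hu] at h1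
  set Z := VectorField.lieBracket ℂ F.E X u
  have h3 : F.mul u Z (X u) = F.mul u Z (X u) + F.mul u Z (X u) + X u := by
    have h4 := congrArg (fun Y => F.mul u Y (X u)) h1
    simp only [F.add_mul_of_mem huc, F.mul_assoc_of_mem huc, hidem u hu] at h4
    exact h4
  have h5 : F.mul u Z (X u) = -X u := by
    have := sub_eq_zero.2 h3
    rw [← sub_eq_zero, ← neg_eq_zero, ← this]
    abel
  rw [h1, h5]
  abel

/-- Canonical coordinates from a holomorphic frame of orthogonal idempotents: `v^i = θ^i(E)`,
where `θ^i` is the dual frame. -/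
theorem exists_canonicalCoordinates {B : Set (Fin N → ℂ)} (hB : IsOpen B)
    (π : Fin N → (Fin N → ℂ) → Fin N → ℂ) (hd : ∀ w ∈ B, ∀ i, DifferentiableAt ℂ (π i) w)
    (hf : ∀ w ∈ B, F.IsFrame w (of fun i b => π i w b) (of fun i b => π i w b)⁻¹) :
    Nonempty (F.CanonicalCoordinates B) := by
  set P : (Fin N → ℂ) → Matrix (Fin N) (Fin N) ℂ := fun w => of fun i b => π i w b with hP
  set Θ : (Fin N → ℂ) → Matrix (Fin N) (Fin N) ℂ := fun w => (P w)⁻¹ with hΘ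
  have hf' : ∀ w ∈ B, F.IsFrame w (P w) (Θ w) := hf
  have hPd : ∀ w ∈ B, ∀ i b, DifferentiableAt ℂ (fun w => P w i b) w := fun w hw i b =>
    differentiableAt_pi.1 (hd w hw i) b
  have hΘd : ∀ w ∈ B, ∀ b j, DifferentiableAt ℂ (fun w => Θ w b j) w := by
    intro w hw b j
    refine DifferentiableAt.matrix_inv_apply (hPd w hw) (fun h0 => ?_) b j
    have := congrArg Matrix.det (hf' w hw).mul_eq_one
    rw [det_mul, h0] at this
    simp at this
  have hEd : ∀ w ∈ B, ∀ b, DifferentiableAt ℂ (fun w => F.E w b) w := fun w hw b =>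
    differentiableAt_pi.1 (F.differentiableAt_E (hf' w hw).mem) b
  -- Closedness of the dual coframe by first-order perturbation theory. The column `θ^j` is an
  -- eigenvector of `A_b` with eigenvalue `θ^j_b`; differentiating and pairing with the left
  -- eigenvector `π_j` cancels the derivative of the eigenvector. The eigenvalue's derivative is
  -- then `⟨π_j, (∂_a A_b) θ^j⟩`, symmetric in `a` and `b`.
  have hclosed : ∀ u ∈ B, ∀ a b j,
      coordDeriv a (fun w => Θ w b j) u = coordDeriv b (fun w => Θ w a j) u := by
    intro u hu
    suffices h : ∀ a b j, coordDeriv a (fun w => Θ w b j) u =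
        ∑ d, ∑ c, P u j d * coordDeriv a (fun w => F.A w b d c) u * Θ u c j by
      intro a b j
      rw [h, h]
      refine Finset.sum_congr rfl fun d _ => Finset.sum_congr rfl fun c _ => ?_
      rw [F.coordDeriv_A_comm (hf' u hu).mem]
    intro a b j
    have hmul : ∀ w ∈ B, ∀ d, ∑ c, F.A w b d c * Θ w c j = Θ w d j * Θ w b j := by
      intro w hw d
      rw [← Matrix.mul_apply, F.A_eq_contractA, (hf' w hw).contractA_eq, mul_assoc,
        (hf' w hw).mul_eq_one, mul_one, mul_diagonal]
      simp
    have hmul' : ∀ c, ∑ d, P u j d * F.A u b d c = Θ u b j * P u j c := by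
      intro c
      rw [← Matrix.mul_apply, F.A_eq_contractA, (hf' u hu).contractA_eq, mul_assoc, ← mul_assoc,
        (hf' u hu).mul_eq_one, one_mul, diagonal_mul]
      simp
    have hone : ∑ d, P u j d * Θ u d j = 1 := by
      rw [← Matrix.mul_apply, (hf' u hu).mul_eq_one, one_apply_eq]
    have hder : ∀ d, ∑ c, (F.A u b d c * coordDeriv a (fun w => Θ w c j) u
        + Θ u c j * coordDeriv a (fun w => F.A w b d c) u) =
        Θ u d j * coordDeriv a (fun w => Θ w b j) u
          + Θ u b j * coordDeriv a (fun w => Θ w d j) u := by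
      intro d
      have h1 : HasFDerivAt (fun w => ∑ c, F.A w b d c * Θ w c j) _ u :=
        HasFDerivAt.fun_sum fun c _ => HasFDerivAt.fun_mul
          (F.differentiableAt_A (hf' u hu).mem b d c).hasFDerivAt (hΘd u hu c j).hasFDerivAt
      have h2 : HasFDerivAt (fun w => Θ w d j * Θ w b j) _ u :=
        HasFDerivAt.fun_mul (hΘd u hu d j).hasFDerivAt (hΘd u hu b j).hasFDerivAt
      have h3 := hB.fderiv_congr hu fun w hw => hmul w hw d
      rw [h1.fderiv, h2.fderiv] at h3
      have h4 := congrArg (fun L : (Fin N → ℂ) →L[ℂ] ℂ => L (Pi.single a 1)) h3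
      simp only [_root_.sum_apply, _root_.add_apply, _root_.smul_apply, smul_eq_mul] at h4
      exact h4
    have hsum : ∑ d, P u j d * ∑ c, (F.A u b d c * coordDeriv a (fun w => Θ w c j) u
        + Θ u c j * coordDeriv a (fun w => F.A w b d c) u) =
        ∑ d, P u j d * (Θ u d j * coordDeriv a (fun w => Θ w b j) u
          + Θ u b j * coordDeriv a (fun w => Θ w d j) u) :=
      Finset.sum_congr rfl fun d _ => by rw [hder]
    have hL : ∑ d, P u j d * ∑ c, (F.A u b d c * coordDeriv a (fun w => Θ w c j) u
        + Θ u c j * coordDeriv a (fun w => F.A w b d c) u) =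
        (∑ c, (∑ d, P u j d * F.A u b d c) * coordDeriv a (fun w => Θ w c j) u)
        + ∑ d, ∑ c, P u j d * coordDeriv a (fun w => F.A w b d c) u * Θ u c j := by
      simp only [Finset.sum_mul]
      rw [Finset.sum_comm, ← Finset.sum_add_distrib]
      refine Finset.sum_congr rfl fun d _ => ?_
      rw [← Finset.sum_add_distrib, Finset.mul_sum]
      exact Finset.sum_congr rfl fun c _ => by ring
    have hR : ∑ d, P u j d * (Θ u d j * coordDeriv a (fun w => Θ w b j) u
          + Θ u b j * coordDeriv a (fun w => Θ w d j) u) =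
        (∑ d, P u j d * Θ u d j) * coordDeriv a (fun w => Θ w b j) u
          + ∑ d, Θ u b j * P u j d * coordDeriv a (fun w => Θ w d j) u := by
      rw [Finset.sum_mul, ← Finset.sum_add_distrib]
      exact Finset.sum_congr rfl fun d _ => by ring
    rw [hL, hR, hone] at hsum
    simp only [hmul'] at hsum
    linear_combination -hsum
  have hvd : ∀ u ∈ B, ∀ j, HasFDerivAt (fun w => (F.E w ᵥ* Θ w) j)
      (∑ b, (F.E u b • fderiv ℂ (fun w => Θ w b j) u
        + Θ u b j • fderiv ℂ (fun w => F.E w b) u)) u := by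
    intro u hu j
    have h : HasFDerivAt (fun w => ∑ b, F.E w b * Θ w b j) _ u := HasFDerivAt.fun_sum fun b _ =>
      HasFDerivAt.fun_mul (hEd u hu b).hasFDerivAt (hΘd u hu b j).hasFDerivAt
    exact h
  -- As `θ^j` is closed, `π_k(θ^j(E)) = E(θ^j(π_k)) - θ^j([E, π_k])`. The first term is the
  -- derivative of a constant, and `[E, π_k] = -π_k`.
  have hdual : ∀ u ∈ B, ∀ j k, fderiv ℂ (fun w => (F.E w ᵥ* Θ w) j) u (π k u) =
      if j = k then 1 else 0 := by
    intro u hu j k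
    have hrow : ∀ w ∈ B, ∑ a, P w k a * Θ w a j = if j = k then 1 else 0 := by
      intro w hw
      rw [← Matrix.mul_apply, (hf' w hw).mul_eq_one, one_apply]
      simp [eq_comm]
    have h1 : HasFDerivAt (fun w => ∑ a, P w k a * Θ w a j) _ u :=
      HasFDerivAt.fun_sum fun a _ =>
        HasFDerivAt.fun_mul (hPd u hu k a).hasFDerivAt (hΘd u hu a j).hasFDerivAt
    have h2 := hB.fderiv_congr hu hrow
    rw [h1.fderiv, fderiv_fun_const] at h2
    have h3 := congrArg (fun L : (Fin N → ℂ) →L[ℂ] ℂ => L (F.E u)) h2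
    simp only [_root_.sum_apply, _root_.add_apply, _root_.smul_apply, smul_eq_mul, Pi.zero_apply,
      _root_.zero_apply, Finset.sum_add_distrib] at h3
    have hbr : ∀ a, fderiv ℂ (fun w => P w k a) u (F.E u) - fderiv ℂ (fun w => F.E w a) u (π k u) =
        -P u k a := by
      intro a
      have := congrFun (IsFrame.lieBracket_E hB hu (hf' u hu).mem (hd u hu k)
        fun w hw => ((hf' w hw).idem k k).trans (if_pos rfl)) a
      rw [VectorField.lieBracket_eq] at this
      simp only [Pi.sub_apply, fderiv_apply_pi (hd u hu k),
        fderiv_apply_pi (F.differentiableAt_E (hf' u hu).mem)] at this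
      exact this
    have hsymm : ∑ b, F.E u b * fderiv ℂ (fun w => Θ w b j) u (π k u) =
        ∑ a, P u k a * fderiv ℂ (fun w => Θ w a j) u (F.E u) := by
      simp only [fderiv_apply_eq_sum_coordDeriv, Finset.mul_sum]
      rw [Finset.sum_comm]
      refine Finset.sum_congr rfl fun a _ => Finset.sum_congr rfl fun b _ => ?_
      rw [hclosed u hu a b j]
      change _ * (π k u a * _) = π k u a * _
      ring
    rw [(hvd u hu j).fderiv]
    simp only [_root_.sum_apply, _root_.add_apply, _root_.smul_apply, smul_eq_mul,
      Finset.sum_add_distrib]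
    rw [hsymm, ← hrow u hu]
    have h4 : ∑ a, P u k a * Θ u a j = ∑ a, Θ u a j * fderiv ℂ (fun w => F.E w a) u (π k u)
        - ∑ a, Θ u a j * fderiv ℂ (fun w => P w k a) u (F.E u) := by
      rw [← Finset.sum_sub_distrib]
      refine Finset.sum_congr rfl fun a _ => ?_
      linear_combination Θ u a j * hbr a
    rw [h4]
    linear_combination h3
  exact ⟨{ v := fun j w => (F.E w ᵥ* Θ w) j
           π := π
           differentiable_v := fun j u hu =>
             (hvd u hu j).differentiableAt.differentiableWithinAt
           dual := hdual
           idempotent := fun u hu => (hf' u hu).idem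
           euler := fun u hu => (hf' u hu).eq_sum (F.E u) }⟩

/-- The restriction of canonical coordinates to a smaller set. -/
def CanonicalCoordinates.restrict {B U : Set (Fin N → ℂ)} (κ : F.CanonicalCoordinates B)
    (hUB : U ⊆ B) : F.CanonicalCoordinates U where
  v := κ.v
  π := κ.π
  differentiable_v i := (κ.differentiable_v i).mono hUB
  dual u hu := κ.dual u (hUB hu)
  idempotent u hu := κ.idempotent u (hUB hu)
  euler u hu := κ.euler u (hUB hu)

variable (F)

theorem exists_canonical_data {p : Fin N → ℂ} (hp : p ∈ F.semisimpleLocus) :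
    ∃ U : Set (Fin N → ℂ), IsOpen U ∧ p ∈ U ∧ U ⊆ F.semisimpleLocus ∧
      ∃ (κ : F.CanonicalCoordinates U) (T : (Fin N → ℂ) → ℂ) (L : Fin N → (Fin N → ℂ) → ℂ),
        κ.IsLogTau T ∧ κ.IsLogEta L := by
  obtain ⟨r, hr, π, hπ⟩ := F.exists_frameField hp
  have hB := Metric.isOpen_ball (x := p) (ε := r)
  obtain ⟨κ⟩ := exists_canonicalCoordinates hB π (fun w hw => (hπ w hw).1) fun w hw => (hπ w hw).2
  have hBF : Metric.ball p r ⊆ F.carrier := fun w hw => (hπ w hw).2.mem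
  have hpB : p ∈ Metric.ball p r := Metric.mem_ball_self hr
  have hp0 := κ.etaI_ne_zero hBF hpB
  -- Near `p` the ratio `η_i / η_i(p)` is close to `1`, so its principal logarithm is holomorphic;
  -- adding `log η_i(p)` gives a branch of `log η_i`.
  have hev : ∀ᶠ w in nhds p, w ∈ Metric.ball p r ∧
      ∀ i, κ.etaI i w / κ.etaI i p ∈ Complex.slitPlane := by
    refine (hB.eventually_mem hpB).and (Filter.eventually_all.2 fun i => ?_)
    have hc : ContinuousAt (fun w => κ.etaI i w / κ.etaI i p) p :=
      (κ.differentiableAt_etaI hB hBF hpB i).continuousAt.div_const _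
    refine hc.eventually_mem (Complex.isOpen_slitPlane.mem_nhds ?_)
    rw [div_self (hp0 i)]
    exact Complex.one_mem_slitPlane
  obtain ⟨s, hs, hball⟩ := Metric.eventually_nhds_iff_ball.1 hev
  have hU := Metric.isOpen_ball (x := p) (ε := s)
  have hUB : Metric.ball p s ⊆ Metric.ball p r := fun w hw => (hball w hw).1
  have hUF := hUB.trans hBF
  -- The Poincaré lemma on a convex ball.
  obtain ⟨T, hT⟩ := Convex.exists_forall_hasFDerivAt_of_fderiv_symmetric (𝕜 := ℂ)
    (ω := (κ.restrict hUB).alpha) (convex_ball p s) hU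
    (fun w hw => (((κ.restrict hUB).differentiableAt_alpha hU hUF hw).1.restrictScalars
      ℝ).differentiableWithinAt)
    (fun w hw x y => by
      have h := (κ.restrict hUB).differentiableAt_alpha hU hUF hw
      rw [h.1.fderiv_restrictScalars ℝ]
      exact h.2 x y)
  refine ⟨Metric.ball p s, hU, Metric.mem_ball_self hs,
    fun w hw => (hπ w (hUB hw)).2.mem_semisimpleLocus, κ.restrict hUB, T,
    fun i w => Complex.log (κ.etaI i w / κ.etaI i p) + Complex.log (κ.etaI i p), hT,
    fun i => ⟨fun w hw => ?_, fun w hw => ?_⟩⟩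
  · refine DifferentiableAt.differentiableWithinAt ?_
    exact (((κ.differentiableAt_etaI hB hBF (hUB hw) i).mul_const ((κ.etaI i p)⁻¹)).clog
      (by simpa only [div_eq_mul_inv] using (hball w hw).2 i)).add_const _
  · rw [Complex.exp_add, Complex.exp_log (div_ne_zero (κ.etaI_ne_zero hBF (hUB hw) i) (hp0 i)),
      Complex.exp_log (hp0 i), div_mul_cancel₀ _ (hp0 i)]
    rfl

end FrobeniusManifold

end

/-! ### Uniqueness at generic jets: nondegeneracy of the residues -/

noncomputable section

open Matrix

namespace FrobeniusManifold

variable {N : ℕ} (F : FrobeniusManifold N)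

/-- The action of `δ_z` on covector-valued power series modulo negative powers of `z`. -/
def deltaNat (u : Fin N → ℂ) : (ℕ → Fin N → ℂ) →ₗ[ℂ] (ℕ → Fin N → ℂ) where
  toFun θ j := ((j : ℂ) + 1) • θ (j + 1)
    + (F.mu u + (1 / 2 : ℂ) • (1 : Matrix (Fin N) (Fin N) ℂ)) *ᵥ θ (j + 1)
    + F.calU u *ᵥ θ j
  map_add' θ θ' := by
    ext1 j
    simp only [Pi.add_apply, mulVec_add, smul_add]
    abel
  map_smul' c θ := by
    ext1 j
    simp only [Pi.smul_apply, mulVec_smul, smul_add, RingHom.id_apply, smul_comm _ c]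

theorem deltaNat_apply (u : Fin N → ℂ) (θ : ℕ → Fin N → ℂ) (j : ℕ) :
    F.deltaNat u θ j = ((j : ℂ) + 1) • θ (j + 1)
      + (F.mu u + (1 / 2 : ℂ) • (1 : Matrix (Fin N) (Fin N) ℂ)) *ᵥ θ (j + 1)
      + F.calU u *ᵥ θ j := rfl

theorem deltaZ_iterate_natCast (u : Fin N → ℂ) (θ : ℤ → Fin N → ℂ) (m : ℕ) (j : ℕ) :
    (F.deltaZ u)^[m] θ j = (F.deltaNat u ^ m) (fun k : ℕ => θ k) j := by
  induction m generalizing j with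
  | zero => rfl
  | succ m ih =>
    rw [Function.iterate_succ_apply', deltaZ_apply, pow_succ', Module.End.mul_apply,
      deltaNat_apply, ← ih, ← ih]
    push_cast
    rfl

theorem deltaNat_pow_eq_zero (u : Fin N → ℂ) {θ : ℕ → Fin N → ℂ} {n : ℕ}
    (hθ : ∀ j, n < j → θ j = 0) (m : ℕ) : ∀ j, n < j → (F.deltaNat u ^ m) θ j = 0 := by
  induction m with
  | zero => exact hθ
  | succ m ih =>
    intro j hj
    rw [pow_succ', Module.End.mul_apply, deltaNat_apply, ih j hj, ih (j + 1) (by lia)]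
    simp

theorem faaDiBruno_of_lt {ℓ k : ℕ} (h : ℓ < k) (u : Jet N) : F.faaDiBruno ℓ k u = 0 := by
  induction ℓ generalizing k u with
  | zero =>
    obtain ⟨k, rfl⟩ := Nat.exists_eq_succ_of_ne_zero h.ne'
    rfl
  | succ ℓ ih =>
    obtain ⟨k, rfl⟩ := Nat.exists_eq_succ_of_ne_zero (by lia : k ≠ 0)
    ext a b
    have h1 : ∀ w, F.faaDiBruno ℓ (k + 1) w a b = 0 := fun w => by rw [ih (by lia)]; rfl
    simp [faaDiBruno, totalDeriv, lineDeriv, h1, ih (by lia : ℓ < k)]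

/-- The leading coefficient of `P_(ℓ+1)`. It makes `σ` triangular in the partial derivatives of `f`,
with invertible diagonal where `𝒳` is invertible. -/
theorem faaDiBruno_self (ℓ : ℕ) (u : Jet N) : F.faaDiBruno ℓ ℓ u = F.calX u ^ (ℓ + 1) := by
  induction ℓ with
  | zero => simp [faaDiBruno]
  | succ ℓ ih =>
    have h1 : ∀ a b, (fun w => F.faaDiBruno ℓ (ℓ + 1) w a b) = fun _ => 0 :=
      fun a b => funext fun w => by rw [F.faaDiBruno_of_lt (by lia)]; rfl
    ext a b
    simp only [faaDiBruno, h1, ih, pow_succ' _ (ℓ + 1)]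
    simp [totalDeriv, lineDeriv]

theorem sigmaSeries_natCast {f : Jet N → ℂ} {u : Jet N} {n : ℕ}
    (hf : ∀ ℓ, n < ℓ → ∀ a, jetPartial ℓ a f u = 0) (k : ℕ) :
    F.sigmaSeries f u k =
      ∑ ℓ ∈ Finset.range (n + 1), F.faaDiBruno ℓ k u *ᵥ fun a => jetPartial ℓ a f u := by
  refine finsum_eq_sum_of_support_subset _ fun ℓ hℓ => ?_
  by_contra h
  refine hℓ ?_
  have : (fun a => jetPartial ℓ a f u) = 0 := funext fun a =>
    hf ℓ (by simpa [Nat.lt_succ_iff] using h) a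
  simp only [this, mulVec_zero]

theorem virasoroField_eq_sum {f : Jet N → ℂ} {u : Jet N} {n : ℕ}
    (hf : ∀ ℓ, n < ℓ → ∀ a, jetPartial ℓ a f u = 0) (m : ℕ) :
    F.virasoroField m f u = ∑ j ∈ Finset.range (n + 1), F.sVec j u ⬝ᵥ
      (F.deltaNat (u 0) ^ m) (fun k => ∑ ℓ ∈ Finset.range (n + 1),
        F.faaDiBruno ℓ k u *ᵥ fun a => jetPartial ℓ a f u) j := by
  simp only [virasoroField, deltaZ_iterate_natCast, F.sigmaSeries_natCast hf]
  refine finsum_eq_sum_of_support_subset _ fun j hj => ?_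
  by_contra h
  refine hj ?_
  have hj' : n < j := by simpa [Nat.lt_succ_iff] using h
  have h0 := F.deltaNat_pow_eq_zero (u 0) (n := n) (θ := fun k => ∑ ℓ ∈ Finset.range (n + 1),
    F.faaDiBruno ℓ k u *ᵥ fun a => jetPartial ℓ a f u) (fun k hk => Finset.sum_eq_zero
      fun ℓ hℓ => by
        rw [F.faaDiBruno_of_lt (by have := Finset.mem_range.1 hℓ; lia), zero_mulVec]) m j hj'
  simp only [h0, dotProduct_zero]

namespace IsFrame

variable {F} {u : Jet N} {P Θ : Matrix (Fin N) (Fin N) ℂ}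

theorem mulVec_calU {u : Fin N → ℂ} (h : F.IsFrame u P Θ) (ξ : Fin N → ℂ) (i : Fin N) :
    (P *ᵥ (F.calU u *ᵥ ξ)) i = (F.E u ᵥ* Θ) i * (P *ᵥ ξ) i := by
  rw [mulVec_mulVec, calU, h.contractA_eq, mul_assoc, ← mul_assoc P, h.mul_eq_one, one_mul,
    ← mulVec_mulVec, mulVec_diagonal]

theorem mulVec_eq_zero_iff {u : Fin N → ℂ} (h : F.IsFrame u P Θ) {ξ : Fin N → ℂ} :
    P *ᵥ ξ = 0 ↔ ξ = 0 := by
  refine ⟨fun h0 => ?_, fun h0 => by rw [h0, mulVec_zero]⟩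
  rw [← one_mulVec ξ, ← h.mul_eq_one', ← mulVec_mulVec, h0, mulVec_zero]

theorem det_calX (h : F.IsFrame (u 0) P Θ) : (F.calX u).det = ∏ i, (u 1 ᵥ* Θ) i := by
  have h1 : (P * F.calX u * Θ).det = ∏ i, (u 1 ᵥ* Θ) i := by
    rw [calX, h.conj_contractA, det_diagonal]
  rw [← h1, det_mul, det_mul, mul_comm (P.det), mul_assoc, ← det_mul, h.mul_eq_one, det_one,
    mul_one]

/-- An eigenvector of `𝒰` with simple spectrum pairs nontrivially with `s_1`. -/
theorem sVec_zero_dotProduct_ne_zero (h : F.IsFrame (u 0) P Θ) (hX : (F.calX u).det ≠ 0)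
    {ξ : Fin N → ℂ} {i : Fin N} (hi : (P *ᵥ ξ) i ≠ 0) (hj : ∀ j, j ≠ i → (P *ᵥ ξ) j = 0) :
    F.sVec 0 u ⬝ᵥ ξ ≠ 0 := by
  have hprod := hX
  rw [h.det_calX, Finset.prod_ne_zero_iff] at hprod
  set y := (F.calX u)⁻¹ *ᵥ ξ with hy
  -- `𝒳` is diagonal with nonzero entries, so `𝒳⁻¹ ξ` has the same single nonzero component as `ξ`;
  -- pairing with `e` returns that component.
  have hξ : ∀ j, (P *ᵥ ξ) j = (u 1 ᵥ* Θ) j * (P *ᵥ y) j := by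
    intro j
    have h1 : ξ = F.calX u *ᵥ y := by
      rw [hy, mulVec_mulVec, mul_nonsing_inv _ (isUnit_iff_ne_zero.2 hX), one_mulVec]
    conv_lhs => rw [h1]
    rw [mulVec_mulVec, calX, h.contractA_eq, mul_assoc, ← mul_assoc P, h.mul_eq_one, one_mul,
      ← mulVec_mulVec, mulVec_diagonal]
  have h2 : F.sVec 0 u ⬝ᵥ ξ = -(P *ᵥ y) i := by
    rw [sVec, neg_dotProduct, ← dotProduct_mulVec, ← hy]
    have h3 := h.e_dotProduct_mulVec 1 y
    rw [one_mulVec, mul_one, h.mul_eq_one, one_mulVec] at h3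
    rw [h3, Finset.sum_eq_single i]
    · intro j _ hji
      have := hξ j
      rw [hj j hji] at this
      exact (mul_eq_zero.1 this.symm).resolve_left (hprod j (Finset.mem_univ j))
    · simp
  rw [h2, neg_ne_zero]
  intro h0
  rw [hξ, h0, mul_zero] at hi
  exact hi rfl

/-- Where `𝒰` has simple spectrum, the functionals `Res ⟨s(z), z δ_z^m θ⟩` determine `θ`. -/
theorem eq_zero_of_forall_residue (h : F.IsFrame (u 0) P Θ) (hX : (F.calX u).det ≠ 0)
    (hE : Function.Injective (F.E (u 0) ᵥ* Θ)) {n : ℕ} {θ : ℕ → Fin N → ℂ}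
    (hθ : ∀ j, n < j → θ j = 0)
    (hres : ∀ m, ∑ j ∈ Finset.range (n + 1),
      F.sVec j u ⬝ᵥ (F.deltaNat (u 0) ^ m) θ j = 0) : θ = 0 := by
  set D := F.deltaNat (u 0) with hD
  -- All polynomials of degree at most `n` killed by the functionals. Applying `D` shifts `m` to `m
  -- + 1`, so this space is `D`-stable; being finite-dimensional, it has an eigenvector unless it is
  -- zero.
  let V : Submodule ℂ (ℕ → Fin N → ℂ) :=
    { carrier := {θ | (∀ j, n < j → θ j = 0) ∧
        ∀ m, ∑ j ∈ Finset.range (n + 1), F.sVec j u ⬝ᵥ (D ^ m) θ j = 0}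
      add_mem' := fun {a b} ha hb => ⟨fun j hj => by rw [Pi.add_apply, ha.1 j hj, hb.1 j hj, add_zero],
        fun m => by
          simp only [map_add, Pi.add_apply, dotProduct_add, Finset.sum_add_distrib, ha.2 m, hb.2 m,
            add_zero]⟩
      zero_mem' := ⟨fun j _ => rfl, fun m => by simp⟩
      smul_mem' := fun c a ha => ⟨fun j hj => by rw [Pi.smul_apply, ha.1 j hj, smul_zero],
        fun m => by
          simp only [map_smul, Pi.smul_apply, dotProduct_smul, ← Finset.smul_sum, ha.2 m,
            smul_zero]⟩ }
  have hVD : ∀ θ ∈ V, D θ ∈ V := fun θ hθ => ⟨F.deltaNat_pow_eq_zero (u 0) hθ.1 1, fun m => by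
    have := hθ.2 (m + 1)
    rwa [pow_succ] at this⟩
  let ρ : V →ₗ[ℂ] (Fin (n + 1) → Fin N → ℂ) :=
    (LinearMap.funLeft ℂ (Fin N → ℂ) (fun j : Fin (n + 1) => (j : ℕ))) ∘ₗ V.subtype
  have hρ : Function.Injective ρ := by
    refine (injective_iff_map_eq_zero ρ).2 fun θ hθ => Subtype.ext (funext fun j => ?_)
    by_cases hj : n < j
    · exact θ.2.1 j hj
    · exact congrFun hθ ⟨j, by lia⟩
  have : FiniteDimensional ℂ V := FiniteDimensional.of_injective ρ hρ
  suffices hV : Subsingleton V from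
    congrArg Subtype.val (Subsingleton.elim (⟨θ, hθ, hres⟩ : V) 0)
  by_contra hV
  rw [not_subsingleton_iff_nontrivial] at hV
  obtain ⟨l, hl⟩ := Module.End.exists_eigenvalue (D.restrict hVD)
  obtain ⟨⟨ψ, hψ0, hψres⟩, hψ⟩ := hl.exists_hasEigenvector
  have hψne : ψ ≠ 0 := fun h0 => hψ.2 (Subtype.ext h0)
  have hψl : D ψ = l • ψ := congrArg Subtype.val hψ.apply_eq_smul
  obtain ⟨k, hk, hkl⟩ : ∃ k, ψ k ≠ 0 ∧ ∀ j, k < j → ψ j = 0 := by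
    classical
    have hex : ∃ k, ∀ j, k ≤ j → ψ j = 0 := ⟨n + 1, fun j hj => hψ0 j (by lia)⟩
    have hspec := Nat.find_spec hex
    have hpos : Nat.find hex ≠ 0 := fun h0 => hψne (funext fun j => hspec j (by lia))
    obtain ⟨k, hk⟩ := Nat.exists_eq_succ_of_ne_zero hpos
    have hmin := Nat.find_min hex (m := k) (by lia)
    push Not at hmin
    obtain ⟨j, hj, hjne⟩ := hmin
    have : j = k := by
      by_contra hjk
      exact hjne (hspec j (by lia))
    exact ⟨k, this ▸ hjne, fun j hj => hspec j (by lia)⟩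
  -- The top coefficient is an eigenvector of `𝒰`; simplicity of the spectrum confines it to one
  -- canonical direction.
  have htop : ∀ i, ((F.E (u 0) ᵥ* Θ) i - l) * (P *ᵥ ψ k) i = 0 := by
    intro i
    have h1 := congrFun hψl k
    rw [hD, deltaNat_apply, hkl (k + 1) (by lia), smul_zero, mulVec_zero, zero_add, zero_add] at h1
    have h2 := h.mulVec_calU (ψ k) i
    rw [h1, Pi.smul_apply, mulVec_smul, Pi.smul_apply, smul_eq_mul] at h2
    linear_combination -h2
  obtain ⟨i, hi⟩ : ∃ i, (P *ᵥ ψ k) i ≠ 0 := by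
    by_contra hall
    push Not at hall
    exact hk (h.mulVec_eq_zero_iff.1 (funext hall))
  have hil : (F.E (u 0) ᵥ* Θ) i = l :=
    sub_eq_zero.1 ((mul_eq_zero.1 (htop i)).resolve_right hi)
  have hother : ∀ j, j ≠ i → (P *ᵥ ψ k) j = 0 := by
    intro j hji
    refine (mul_eq_zero.1 (htop j)).resolve_left fun h0 => hji (hE ?_)
    rw [hil, sub_eq_zero.1 h0]
  rcases k with _ | k
  · have h1 := hψres 0
    rw [Finset.sum_eq_single 0] at h1
    · exact h.sVec_zero_dotProduct_ne_zero hX hi hother h1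
    · intro j _ hj
      rw [pow_zero, Module.End.one_apply, hkl j (Nat.pos_of_ne_zero hj), dotProduct_zero]
    · simp
  -- With top degree `k + 1`, take the `i`-th component of the coefficient of `z^k`: the `𝒰` term
  -- cancels against the eigenvalue and the diagonal of `μ` vanishes. What remains is `k + 3/2`
  -- times a nonzero number. Top degree zero was excluded by `s_1`, so no higher `s_k` is needed.
  · have h1 := congrFun hψl k
    rw [hD, deltaNat_apply] at h1
    have h2 := congrFun (congrArg (P *ᵥ ·) h1) i
    simp only [mulVec_add, add_mulVec, mulVec_smul, Pi.add_apply, Pi.smul_apply, smul_mulVec,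
      one_mulVec, smul_eq_mul, h.mulVec_calU, hil] at h2
    have h3 : (P *ᵥ (F.mu (u 0) *ᵥ ψ (k + 1))) i = 0 := by
      have h4 : P *ᵥ (F.mu (u 0) *ᵥ ψ (k + 1)) =
          (P * F.mu (u 0) * Θ) *ᵥ (P *ᵥ ψ (k + 1)) := by
        rw [mulVec_mulVec, mulVec_mulVec, mul_assoc _ Θ, h.mul_eq_one', mul_one]
      rw [h4, mulVec, dotProduct, Finset.sum_eq_single i]
      · rw [h.conj_mu_diag, zero_mul]
      · intro j _ hji
        rw [hother j hji, mul_zero]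
      · simp
    rw [h3] at h2
    have h5 : ((k : ℂ) + 1 + 1 / 2) * (P *ᵥ ψ (k + 1)) i = 0 := by linear_combination h2
    refine (mul_eq_zero.1 h5).elim (fun h0 => ?_) hi
    have h6 := congrArg Complex.re h0
    simp at h6
    have : (0 : ℝ) ≤ k := Nat.cast_nonneg k
    linarith

/-- Functions of `n`-jets on which all Virasoro vector fields agree have the same differential, at
jets at which `𝒳` is invertible and `𝒰` has simple spectrum. -/
theorem jetPartial_eq_of_virasoroField_eq (h : F.IsFrame (u 0) P Θ) (hX : (F.calX u).det ≠ 0)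
    (hE : Function.Injective (F.E (u 0) ᵥ* Θ)) {n : ℕ} {f g : Jet N → ℂ}
    (hf : ∀ ℓ, n < ℓ → ∀ a, jetPartial ℓ a f u = 0)
    (hg : ∀ ℓ, n < ℓ → ∀ a, jetPartial ℓ a g u = 0)
    (hfg : ∀ m, F.virasoroField m f u = F.virasoroField m g u) (ℓ : ℕ) (a : Fin N) :
    jetPartial ℓ a f u = jetPartial ℓ a g u := by
  set d : ℕ → Fin N → ℂ := fun ℓ =>
    (fun a => jetPartial ℓ a f u) - fun a => jetPartial ℓ a g u with hd
  have hθ : (fun k => ∑ ℓ ∈ Finset.range (n + 1), F.faaDiBruno ℓ k u *ᵥ d ℓ) =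
      (fun k => ∑ ℓ ∈ Finset.range (n + 1),
        F.faaDiBruno ℓ k u *ᵥ fun a => jetPartial ℓ a f u)
      - fun k => ∑ ℓ ∈ Finset.range (n + 1),
        F.faaDiBruno ℓ k u *ᵥ fun a => jetPartial ℓ a g u := by
    ext1 k
    simp only [hd, mulVec_sub, Finset.sum_sub_distrib, Pi.sub_apply]
  have h0 := h.eq_zero_of_forall_residue hX hE (n := n)
    (θ := fun k => ∑ ℓ ∈ Finset.range (n + 1), F.faaDiBruno ℓ k u *ᵥ d ℓ)
    (fun k hk => Finset.sum_eq_zero fun ℓ hℓ => by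
      rw [F.faaDiBruno_of_lt (by have := Finset.mem_range.1 hℓ; lia), zero_mulVec])
    (fun m => by
      rw [hθ]
      simp only [map_sub, Pi.sub_apply, dotProduct_sub, Finset.sum_sub_distrib]
      rw [← F.virasoroField_eq_sum hf, ← F.virasoroField_eq_sum hg, hfg, sub_self])
  have hdz : ∀ ℓ, n < ℓ → d ℓ = 0 := fun ℓ hℓ => by
    ext a
    simp [hd, hf ℓ hℓ, hg ℓ hℓ]
  -- Downward induction on `k`: once all higher `d ℓ` vanish, the coefficient of `z^k` is `𝒳^(k+1)`
  -- applied to `d k`.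
  have hall : ∀ c k, n < k + c → d k = 0 := by
    intro c
    induction c with
    | zero => exact hdz
    | succ c ih =>
      intro k hk
      by_cases hkn : n < k
      · exact hdz k hkn
      have h1 := congrFun h0 k
      simp only [Pi.zero_apply] at h1
      rw [Finset.sum_eq_single k] at h1
      · rw [F.faaDiBruno_self] at h1
        have hdet : IsUnit (F.calX u ^ (k + 1)).det := by
          rw [det_pow]
          exact (isUnit_iff_ne_zero.2 hX).pow _
        rw [← one_mulVec (d k), ← nonsing_inv_mul _ hdet, ← mulVec_mulVec, h1, mulVec_zero]
      · intro ℓ _ hℓk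
        rcases lt_or_gt_of_ne hℓk with hlt | hgt
        · rw [F.faaDiBruno_of_lt hlt, zero_mulVec]
        · rw [ih ℓ (by lia), mulVec_zero]
      · intro hk'
        exact absurd (Finset.mem_range.2 (by lia)) hk'
  exact sub_eq_zero.1 (congrFun (hall (n + 1) ℓ (by lia)) a)

end IsFrame

end FrobeniusManifold

end

/-! ### Uniqueness at all jets -/

noncomputable section

open Matrix Topology

theorem tendsto_add_smul_nhdsNE {E : Type*} [NormedAddCommGroup E] [NormedSpace ℂ E] (w x : E) :
    Filter.Tendsto (fun t : ℂ => w + t • x) (𝓝[≠] 0) (𝓝 w) := by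
  have hc : Continuous fun t : ℂ => w + t • x := by fun_prop
  simpa using (hc.tendsto 0).mono_left nhdsWithin_le_nhds

theorem ContinuousAt.eq_of_eventually_line {E Y : Type*} [NormedAddCommGroup E]
    [NormedSpace ℂ E] [TopologicalSpace Y] [T2Space Y] {f g : E → Y} {w : E}
    (hf : ContinuousAt f w) (hg : ContinuousAt g w) (x : E)
    (h : ∀ᶠ t : ℂ in 𝓝[≠] 0, f (w + t • x) = g (w + t • x)) : f w = g w := by
  exact tendsto_nhds_unique ((hf.tendsto.comp (tendsto_add_smul_nhdsNE w x)).congr' h)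
    (hg.tendsto.comp (tendsto_add_smul_nhdsNE w x))

theorem jetPartial_truncJet {N n : ℕ} {f : (Fin (n + 1) → Fin N → ℂ) → ℂ} {u : Jet N}
    (hf : DifferentiableAt ℂ f (truncJet n u)) (ℓ : ℕ) (a : Fin N) :
    jetPartial ℓ a (fun w => f (truncJet n w)) u =
      if h : ℓ < n + 1 then fderiv ℂ f (truncJet n u) (Pi.single ⟨ℓ, h⟩ (Pi.single a 1)) else 0 := by
  simp only [jetPartial, lineDeriv]
  split_ifs with h
  · have h1 : ∀ t : ℂ, truncJet n (u + t • (Pi.single ℓ (Pi.single a 1 : Fin N → ℂ) : Jet N)) =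
        truncJet n u +
          t • (Pi.single ⟨ℓ, h⟩ (Pi.single a 1) : Fin (n + 1) → Fin N → ℂ) := by
      intro t
      funext k
      simp [truncJet, Pi.single_apply, Fin.ext_iff]
    simp only [h1]
    exact (hf.hasFDerivAt.hasLineDerivAt _).lineDeriv
  · have h1 : ∀ t : ℂ, truncJet n (u + t • (Pi.single ℓ (Pi.single a 1 : Fin N → ℂ) : Jet N)) =
        truncJet n u := by
      intro t
      funext k
      have : (k : ℕ) ≠ ℓ := fun hk => h (hk ▸ k.2)
      simp [truncJet, this]
    simp only [h1]
    exact deriv_const _ _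

namespace FrobeniusManifold

variable {N : ℕ} {F : FrobeniusManifold N}

theorem IsFrame.fderiv_eq_of_virasoroField_eq {u : Jet N} {P Θ : Matrix (Fin N) (Fin N) ℂ}
    (h : F.IsFrame (u 0) P Θ) (hX : (F.calX u).det ≠ 0)
    (hE : Function.Injective (F.E (u 0) ᵥ* Θ)) {n : ℕ} {f g : (Fin (n + 1) → Fin N → ℂ) → ℂ}
    (hf : DifferentiableAt ℂ f (truncJet n u)) (hg : DifferentiableAt ℂ g (truncJet n u))
    (hfg : ∀ m, F.virasoroField m (fun w => f (truncJet n w)) u =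
      F.virasoroField m (fun w => g (truncJet n w)) u) :
    fderiv ℂ f (truncJet n u) = fderiv ℂ g (truncJet n u) := by
  have hz : ∀ {f : (Fin (n + 1) → Fin N → ℂ) → ℂ}, DifferentiableAt ℂ f (truncJet n u) →
      ∀ ℓ, n < ℓ → ∀ a, jetPartial ℓ a (fun w => f (truncJet n w)) u = 0 := fun hf ℓ hℓ a => by
    rw [jetPartial_truncJet hf, dif_neg (by lia)]
  have key := h.jetPartial_eq_of_virasoroField_eq hX hE (hz hf) (hz hg) hfg
  refine ContinuousLinearMap.coe_injective (LinearMap.pi_ext' fun ℓ => LinearMap.pi_ext' fun a =>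
    LinearMap.ext_ring ?_)
  have := key ℓ a
  rw [jetPartial_truncJet hf, jetPartial_truncJet hg, dif_pos ℓ.2, dif_pos ℓ.2] at this
  exact this

namespace CanonicalCoordinates

variable {U : Set (Fin N → ℂ)} (κ : F.CanonicalCoordinates U) {T : (Fin N → ℂ) → ℂ}
  {L : Fin N → (Fin N → ℂ) → ℂ} {n : ℕ} {W : Set (Fin (n + 1) → Fin N → ℂ)}
  {f : (Fin (n + 1) → Fin N → ℂ) → ℂ}

/-- The infinite jet extending `w` by copies of `e`. -/
def extendJet (F : FrobeniusManifold N) (w : Fin (n + 1) → Fin N → ℂ) : Jet N := fun ℓ =>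
  if h : ℓ < n + 1 then w ⟨ℓ, h⟩ else F.e (w 0)

theorem truncJet_extendJet (w : Fin (n + 1) → Fin N → ℂ) : truncJet n (extendJet F w) = w := by
  funext k
  simp [truncJet, extendJet, k.2]

theorem extendJet_zero (w : Fin (n + 1) → Fin N → ℂ) : extendJet F w 0 = w 0 := by
  simp [extendJet]

theorem eventually_det_calX_extendJet_ne_zero {w : Fin (n + 1) → Fin N → ℂ}
    {P Θ : Matrix (Fin N) (Fin N) ℂ} (h : F.IsFrame (w 0) P Θ) :
    ∃ x : Fin (n + 1) → Fin N → ℂ, x 0 = 0 ∧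
      ∀ᶠ t : ℂ in 𝓝[≠] 0, (F.calX (extendJet F (w + t • x))).det ≠ 0 := by
  rcases n with _ | n
  -- For `n = 0` the entry `u_1` is the default value `e` of `extendJet`, so `𝒳 = A_e = 1`.
  · refine ⟨0, rfl, Filter.Eventually.of_forall fun t => ?_⟩
    simp [calX, extendJet, F.contract_e _ h.mem]
  -- Moving `u_1` along `e` shifts every eigenvalue of `𝒳` by `t`, so `𝒳` is invertible for all
  -- small `t ≠ 0`.
  · set x : Fin (n + 2) → Fin N → ℂ := Pi.single 1 (F.e (w 0)) with hx
    refine ⟨x, by simp [hx], ?_⟩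
    have h0 : ∀ t : ℂ, extendJet F (w + t • x) 0 = w 0 := fun t => by
      rw [extendJet_zero]; simp [hx]
    have h1 : ∀ t : ℂ, extendJet F (w + t • x) 1 = w 1 + t • F.e (w 0) := fun t => by
      rw [extendJet, dif_pos (by lia), show (⟨1, by lia⟩ : Fin (n + 2)) = 1 from rfl]
      simp [hx]
    have h2 : ∀ᶠ t : ℂ in 𝓝[≠] 0, ∀ i, (w 1 ᵥ* Θ) i + t ≠ 0 :=
      Filter.eventually_all.2 fun i =>
        ((hasDerivAt_id (0 : ℂ)).const_add ((w 1 ᵥ* Θ) i)).eventually_ne one_ne_zero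
    filter_upwards [h2] with t ht
    have h3 : F.IsFrame (extendJet F (w + t • x) 0) P Θ := by
      rw [h0]; exact h
    rw [h3.det_calX, Finset.prod_ne_zero_iff, h1]
    intro i _
    rw [add_vecMul, smul_vecMul, h.e_vecMul]
    simpa using ht i

variable (hU : IsOpen U) (hUF : U ⊆ F.carrier)

include hU in
theorem differentiableOn_genusOneG (hT : κ.IsLogTau T) (hL : κ.IsLogEta L)
    (hWU : ∀ w ∈ W, w 0 ∈ U) : DifferentiableOn ℂ (fun w => genusOneG T L (w 0)) W :=
  fun w hw => (DifferentiableAt.comp (𝕜 := ℂ) (g := genusOneG T L) w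
    (hasFDerivAt_genusOneG hU (hWU w hw) hT hL).differentiableAt
    (differentiableAt_apply 0 w)).differentiableWithinAt

-- Jets with singular `𝒳` are limits along a line of jets over the same base point with invertible
-- `𝒳`. The generic result applies there, and the differentials are continuous.
include hU hUF in
theorem fderiv_eq_of_injective_v (hT : κ.IsLogTau T) (hL : κ.IsLogEta L)
    (hW : IsOpen W) (hWU : ∀ w ∈ W, w 0 ∈ U) (hf : DifferentiableOn ℂ f W)
    (hfV : F.GenusOneVirasoro n W f) {w : Fin (n + 1) → Fin N → ℂ} (hw : w ∈ W)
    (hv : Function.Injective fun i => κ.v i (w 0)) :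
    fderiv ℂ f w = fderiv ℂ (fun w => genusOneG T L (w 0)) w := by
  have hg := κ.differentiableOn_genusOneG hU hT hL hWU
  obtain ⟨x, hx0, hx⟩ := eventually_det_calX_extendJet_ne_zero (κ.isFrame hUF (hWU w hw))
  refine ContinuousAt.eq_of_eventually_line
    ((hf.fderiv_of_isOpen hW).continuousOn.continuousAt (hW.mem_nhds hw))
    ((hg.fderiv_of_isOpen hW).continuousOn.continuousAt (hW.mem_nhds hw)) x ?_
  filter_upwards [hx, tendsto_add_smul_nhdsNE w x (hW.mem_nhds hw)] with t ht htW
  have htW : w + t • x ∈ W := htW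
  have ht0 : extendJet F (w + t • x) 0 = w 0 := by rw [extendJet_zero]; simp [hx0]
  have htr := truncJet_extendJet (F := F) (w + t • x)
  have hu : F.IsFrame (extendJet F (w + t • x) 0) (κ.frame (w 0)) (κ.coframe (w 0)) := by
    rw [ht0]; exact κ.isFrame hUF (hWU w hw)
  have hE : Function.Injective (F.E (extendJet F (w + t • x) 0) ᵥ* κ.coframe (w 0)) := by
    rw [ht0, show F.E (w 0) ᵥ* κ.coframe (w 0) = fun i => κ.v i (w 0) from
      funext fun i => κ.E_vecMul_coframe (hWU w hw) i]
    exact hv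
  have hkey := hu.fderiv_eq_of_virasoroField_eq (n := n) (f := f)
    (g := fun w => genusOneG T L (w 0)) ht hE
    (by rw [htr]; exact hf.differentiableAt (hW.mem_nhds htW))
    (by rw [htr]; exact hg.differentiableAt (hW.mem_nhds htW))
    (fun m => (hfV m _ (by rw [htr]; exact htW) ht).trans
      (genusOneVirasoro_genusOneG hU hUF hT hL m (extendJet F (w + t • x))
        (show extendJet F (w + t • x) 0 ∈ U from ht0 ▸ hWU w hw) ht).symm)
  rwa [htr] at hkey

include hU in
theorem exists_direction_injective_v {p : Fin N → ℂ} (hp : p ∈ U) :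
    ∃ ξ : Fin N → ℂ, ∀ᶠ t : ℂ in 𝓝[≠] 0, Function.Injective fun i => κ.v i (p + t • ξ) := by
  obtain ⟨ξ, hξ⟩ : ∃ ξ, ∀ i, fderiv ℂ (κ.v i) p ξ = (i : ℕ) := by
    -- Along this direction `v^i` moves with speed `i`. The speeds are distinct, so coordinates that
    -- coincide at `p` separate at once.
    refine ⟨∑ j : Fin N, ((j : ℕ) : ℂ) • κ.π j p, fun i => ?_⟩
    simp [κ.dual p hp]
  refine ⟨ξ, ?_⟩
  have hd : ∀ i, HasDerivAt (fun t : ℂ => κ.v i (p + t • ξ)) (i : ℕ) 0 := fun i => by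
    rw [← hξ i]
    exact ((κ.differentiable_v i).differentiableAt (hU.mem_nhds hp)).hasFDerivAt.hasLineDerivAt ξ
  have hne : ∀ᶠ t : ℂ in 𝓝[≠] 0, ∀ i j, i ≠ j → κ.v i (p + t • ξ) - κ.v j (p + t • ξ) ≠ 0 := by
    refine Filter.eventually_all.2 fun i => Filter.eventually_all.2 fun j => ?_
    by_cases hij : i = j
    · exact Filter.Eventually.of_forall fun _ h => absurd hij h
    · have h1 : (((i : ℕ) : ℂ) - (j : ℕ)) ≠ 0 :=
        sub_ne_zero.2 fun h => hij (Fin.ext (Nat.cast_injective h))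
      filter_upwards [((hd i).sub (hd j)).eventually_ne (c := 0) h1] with t ht _
      exact ht
  filter_upwards [hne] with t ht i j hij
  by_contra h
  exact ht i j h (sub_eq_zero.2 hij)

include hU hUF in
/-- Solutions of the genus one Virasoro equations are unique up to a constant. -/
theorem exists_eq_genusOneG_add (hT : κ.IsLogTau T) (hL : κ.IsLogEta L)
    (hW : IsOpen W) (hWc : IsPreconnected W) (hWU : ∀ w ∈ W, w 0 ∈ U)
    (hf : DifferentiableOn ℂ f W) (hfV : F.GenusOneVirasoro n W f) :
    ∃ c : ℂ, ∀ w ∈ W, f w = genusOneG T L (w 0) + c := by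
  have hg := κ.differentiableOn_genusOneG hU hT hL hWU
  refine hW.exists_eq_add_of_fderiv_eq hWc hf hg fun w hw => ?_
  obtain ⟨ξ, hξ⟩ := κ.exists_direction_injective_v hU (hWU w hw)
  -- Moving only the base point makes the spectrum of `𝒰` simple; continuity then removes this
  -- genericity condition as well.
  set x : Fin (n + 1) → Fin N → ℂ := Pi.single 0 ξ with hx
  refine ContinuousAt.eq_of_eventually_line
    ((hf.fderiv_of_isOpen hW).continuousOn.continuousAt (hW.mem_nhds hw))
    ((hg.fderiv_of_isOpen hW).continuousOn.continuousAt (hW.mem_nhds hw)) x ?_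
  filter_upwards [hξ, tendsto_add_smul_nhdsNE w x (hW.mem_nhds hw)] with t ht htW
  exact κ.fderiv_eq_of_injective_v hU hUF hT hL hW hWU hf hfV htW (by simpa [hx] using ht)

end CanonicalCoordinates

end FrobeniusManifold

end

theorem mainTheorem9 {N : ℕ} (F : FrobeniusManifold N) (hF : F.IsSemisimple) :
    (∀ p ∈ F.semisimpleLocus, ∃ U : Set (Fin N → ℂ), IsOpen U ∧ p ∈ U ∧ U ⊆ F.semisimpleLocus ∧
      ∃ (κ : F.CanonicalCoordinates U) (T : (Fin N → ℂ) → ℂ) (L : Fin N → (Fin N → ℂ) → ℂ),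
        κ.IsLogTau T ∧ κ.IsLogEta L) ∧
    (∀ U : Set (Fin N → ℂ), IsOpen U → U ⊆ F.semisimpleLocus →
      ∀ (κ : F.CanonicalCoordinates U) (T : (Fin N → ℂ) → ℂ) (L : Fin N → (Fin N → ℂ) → ℂ),
        κ.IsLogTau T → κ.IsLogEta L →
          F.GenusOneVirasoro 0 {w | w 0 ∈ U} (fun w => genusOneG T L (w 0)) ∧
          ∀ (n : ℕ) (W : Set (Fin (n + 1) → Fin N → ℂ)) (f : (Fin (n + 1) → Fin N → ℂ) → ℂ),
            IsOpen W → IsPreconnected W → (∀ w ∈ W, w 0 ∈ U) → DifferentiableOn ℂ f W →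
              F.GenusOneVirasoro n W f →
                ∃ c : ℂ, ∀ w ∈ W, f w = genusOneG T L (w 0) + c) := by
  refine ⟨fun p hp => F.exists_canonical_data hp, fun U hU hUs κ T L hT hL => ?_⟩
  have hUF : U ⊆ F.carrier := fun u hu => (hUs hu).1
  exact ⟨FrobeniusManifold.CanonicalCoordinates.genusOneVirasoro_genusOneG hU hUF hT hL,
    fun n W f hW hWc hWU hf hfV =>
      κ.exists_eq_genusOneG_add hU hUF hT hL hW hWc hWU hf hfV⟩
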